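/- All digraphs are finite and simple. A directed path has pairwise distinct vertices, and a directed cycle has at least $3$ vertices. A *cactus* is a strongly connected digraph $Q$ in which no two vertices $u,v$ have both arcs $uv$ and $vu$, and in which every arc belongs to exactly one directed cycle. It is an *$(n,q)$-cactus* if it has $n$ vertices and its arc set decomposes into $q$ directed cycles. For a strongly connected digraph $D$ which has a pair of distinct vertices $u,v$ without the arc $uv$, the *rainbow vertex-connection number* $\overset{\rightarrow}{rvc}(D)$ is the minimum number of colours in a colouring of the vertices of $D$ such that for every ordered pair $(u,v)$ of vertices there is a directed $u$–$v$ path whose internal vertices have distinct colours. The *total rainbow connection number* $\overset{\rightarrow}{trc}(D)$ is the minimum number of colours in a colouring of the vertices and arcs of $D$ such that for every ordered pair $(u,v)$ of vertices there is a directed $u$–$v$ path whose arcs and internal vertices have distinct colours. **Theorem 5.9.** Let $q\ge 2$. (a) Let $2\le k\le 2q-2$. For every $n$ with $$n\ge\begin{cases}2q+1 & \text{if } k \text{ is even},\\ 2q+2 & \text{if } k \text{ is odd},\end{cases}$$ there is an $(n,q)$-cactus $Q$ with $\overset{\rightarrow}{rvc}(Q)=n-2q+k$. (b) Let $3\le k\le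 3q-3$ with $k\ne 3q-4$. For every $n$ with $$n\ge\begin{cases}2q+1 & \text{if } k\equiv 0 \pmod 3,\\ 2q+2 & \text{if } k\equiv 1 \pmod 3,\\ 2q+3 & \text{if } k\equiv 2 \pmod 3,\end{cases}$$ there is an $(n,q)$-cactus $Q$ with $\overset{\rightarrow}{trc}(Q)=2n-3q+k$. (c) For every $(n,q)$-cactus $Q$, we have $\overset{\rightarrow}{trc}(Q)\ne 2n-4$. -/

import Mathlib

namespace RainbowDigraph

variable {V : Type*} {α : Type*}

/-- `l` is the list of vertices of a directed path from `u` to `v` in `D`: the vertices are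
distinct, and every vertex is joined by an arc to the next one. -/
def IsDirPath (D : Digraph V) (u v : V) (l : List V) : Prop :=
  l.head? = some u ∧ l.getLast? = some v ∧ l.Nodup ∧ l.IsChain D.Adj

/-- The internal vertices of the path with vertex list `l`. -/
def internalVertices (l : List V) : List V := l.tail.dropLast

/-- The arcs of the path with vertex list `l`. -/
def pathArcs (l : List V) : List (V × V) := l.zip l.tail

/-- The arcs `v₀v₁, …, vₘ₋₁vₘ, vₘv₀` of the closed directed walk through
`l = [v₀, …, vₘ]`. -/
def cycleArcs (l : List V) : Set (V × V) := {p | p ∈ l.zip (l.rotate 1)}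

/-- `C` is the arc set of a directed cycle of `D`. A directed cycle has at least 3 vertices,
and it is identified with its arc set, so that the choice of a first vertex is immaterial. -/
def IsDirCycle (D : Digraph V) (C : Set (V × V)) : Prop :=
  ∃ l : List V, 3 ≤ l.length ∧ l.Nodup ∧ C = cycleArcs l ∧ ∀ p ∈ C, D.Adj p.1 p.2

/-- Every arc is asymmetric (in particular there are no loops). -/
def IsOrientedGraph (D : Digraph V) : Prop := ∀ u v, D.Adj u v → ¬ D.Adj v u

/-- Every ordered pair of vertices is joined by a directed path. -/
def IsStronglyConnected (D : Digraph V) : Prop := ∀ u v, ∃ l, IsDirPath D u v l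

/-- A cactus: a strongly connected oriented graph in which each arc belongs to exactly one
directed cycle. -/
def IsCactus (D : Digraph V) : Prop :=
  IsStronglyConnected D ∧ IsOrientedGraph D ∧
    ∀ u v, D.Adj u v → ∃! C : Set (V × V), IsDirCycle D C ∧ (u, v) ∈ C

/-- `D` decomposes into `q` directed cycles: there are `q` directed cycles of `D` such that
every arc of `D` is in exactly one of them. -/
def HasCycleDecomposition (D : Digraph V) (q : ℕ) : Prop :=
  ∃ H : Fin q → Set (V × V), (∀ i, IsDirCycle D (H i)) ∧
    ∀ u v, D.Adj u v → ∃! i, (u, v) ∈ H i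

/-- An `(n, q)`-cactus: a cactus with `n` vertices that decomposes into `q` cycles. -/
def IsNQCactus [Fintype V] (D : Digraph V) (n q : ℕ) : Prop :=
  IsCactus D ∧ Fintype.card V = n ∧ HasCycleDecomposition D q

/-- The internal vertices of the path `l` have distinct colours. -/
def IsVertexRainbow (c : V → α) (l : List V) : Prop := ((internalVertices l).map c).Nodup

/-- The arcs and internal vertices of the path `l` have distinct colours, where `cV` colours
the vertices and `cA` colours the arcs, from one common set of colours. -/
def IsTotalRainbow (cV : V → α) (cA : V × V → α) (l : List V) : Prop :=
  ((internalVertices l).map cV ++ (pathArcs l).map cA).Nodup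

/-- The vertex-colouring `c` of `D` is rainbow vertex-connected. -/
def IsRainbowVertexConnected (D : Digraph V) (c : V → α) : Prop :=
  ∀ u v, ∃ l, IsDirPath D u v l ∧ IsVertexRainbow c l

/-- The total-colouring of `D` that is given by `cV` on the vertices and by `cA` on the arcs is
total rainbow connected. The values of `cA` at pairs that are not arcs play no role. -/
def IsTotalRainbowConnected (D : Digraph V) (cV : V → α) (cA : V × V → α) : Prop :=
  ∀ u v, ∃ l, IsDirPath D u v l ∧ IsTotalRainbow cV cA l

/-- The rainbow vertex-connection number: the minimum number `k` of colours in a rainbow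
vertex-connected vertex-colouring. (All vertices are coloured. Bioriented complete graphs, where
no path needs an internal vertex and where the value is 0 by convention, are not treated
separately.) -/
noncomputable def rvc (D : Digraph V) : ℕ :=
  sInf {k : ℕ | ∃ c : V → Fin k, IsRainbowVertexConnected D c}

/-- The total rainbow connection number: the minimum number `k` of colours in a total rainbow
connected total-colouring. -/
noncomputable def trc (D : Digraph V) : ℕ :=
  sInf {k : ℕ | ∃ (cV : V → Fin k) (cA : V × V → Fin k), IsTotalRainbowConnected D cV cA}

end RainbowDigraph

/-! In a cactus every ordered pair of vertices is joined by exactly one directed path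
(`IsCactus.hasUniquePaths`), so a colouring is rainbow connected precisely when every directed path
is rainbow. Lower bounds come from single long paths or from sets of arcs and vertices that pairwise
share a path. Upper bounds come from pairs that share no path. Arcs are coloured by their tails,
with a palette disjoint from that of the vertices. Two tails may share a colour if no path leaves
both; two vertices may share a colour if no path leaves both or no path enters both.

For (c), two cycles give a branching vertex, and a branching vertex farthest from a root carries a
leaf cycle: apart from its attaching vertex `w`, it is a path from `a` to `b` that is entered only
by `wa` and left only by `bw` (`exists_isLeaf`). Take two disjoint leaves, with ends `a`, `b` and
`a'`, `b'`. If the path from `a` to `b'` or from `a'` to `b` visits all `n` vertices, it alone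
forces `2n - 3` colours. Otherwise each of these paths misses a vertex, and a missed vertex chosen
farthest from the leaf can share a colour with an end of a leaf (`IsLeaf.exists_neverBothLeft`, also
applied to the reversed digraph). Together with the pairs `a`, `a'` and `b`, `b'` this saves two arc
colours and three vertex colours, so `2n - 5` suffice (`HasUniquePaths.trc_dichotomy`).

For (a) and (b), start from a cycle of length `t + 3`, attach `a` quadrangles and `b` triangles in a
chain, and finally `j + 1` triangles at a single vertex (`exists_isNQCactus`). With `N = t + 3 + 2a
+ 2b`, a path with `N + 2` vertices shows that `rvc` is at least `N`; this path and the middle arcs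
of the other `j` final triangles show that `trc` is at least `2N + j + 1`. Colourings maintained
along the construction attain both. Here `n = 2q + 1 + t + a`, and `k` is `2 + a + 2b` for `rvc` and
`3 + a + 3b` for `trc`; so `a` adjusts the residue of `k`, and `t` adjusts `n`. -/

namespace RainbowDigraph

/-! ### Vertex lists and arc sets of cycles -/

variable {V : Type*} {D : Digraph V} {u v w x y z : V} {l l₁ l₂ : List V}

theorem append_cons_inj_of_nodup {p r p' r' : List V} (hn : (p ++ x :: r).Nodup)
    (h : p ++ x :: r = p' ++ x :: r') : p = p' ∧ r = r' := by
  have h1 : x ∉ p := by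
    rw [List.nodup_append] at hn
    intro hx
    exact hn.2.2 x hx x (by simp) rfl
  have h2 : x ∉ p' := by
    rw [h, List.nodup_append] at hn
    intro hx
    exact hn.2.2 x hx x (by simp) rfl
  rw [List.append_eq_append_iff] at h
  rcases h with ⟨c, rfl, hc⟩ | ⟨c, rfl, hc⟩ <;> cases c <;> simp_all

theorem mem_pathArcs : (x, y) ∈ pathArcs l ↔ ∃ p s, l = p ++ x :: y :: s := by
  unfold pathArcs
  induction l with
  | nil => simp
  | cons a t ih =>
    cases t with
    | nil => simp [List.cons_eq_append_iff]
    | cons b t =>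
      simp only [List.tail_cons, List.zip_cons_cons, List.mem_cons, Prod.mk.injEq] at ih ⊢
      rw [ih]
      constructor
      · rintro (⟨rfl, rfl⟩ | ⟨p, s, h⟩)
        · exact ⟨[], t, rfl⟩
        · exact ⟨a :: p, s, by simp [h]⟩
      · rintro ⟨p, s, h⟩
        cases p with
        | nil => simp at h; left; exact ⟨h.1.symm, h.2.1.symm⟩
        | cons c p => simp at h; right; exact ⟨p, s, h.2⟩

theorem mem_pathArcs_concat {p : V × V} {c d : V} :
    p ∈ pathArcs (l ++ [c] ++ [d]) ↔ p ∈ pathArcs (l ++ [c]) ∨ p = (c, d) := by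
  induction l with
  | nil => simp [pathArcs]
  | cons a t ih =>
    cases t with
    | nil => simp [pathArcs]
    | cons b t => simp [pathArcs] at ih ⊢; rw [ih]; tauto

theorem cycleArcs_cons (a : V) (t : List V) :
    cycleArcs (a :: t) = {p | p ∈ pathArcs (a :: t ++ [a])} := by
  ext p
  simp only [cycleArcs, pathArcs, Set.mem_ofPred_eq]
  have : (a :: t ++ [a]).zip (a :: t ++ [a]).tail = (a :: t).zip (t ++ [a]) := by
    rw [show (a :: t ++ [a]).tail = (t ++ [a]) ++ [] by simp, List.zip_append (by simp)]
    simp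
  rw [this]; simp

theorem cycleArcs_rotate (l : List V) (k : ℕ) : cycleArcs (l.rotate k) = cycleArcs l := by
  ext p
  simp only [cycleArcs, Set.mem_ofPred_eq]
  rw [List.rotate_rotate, Nat.add_comm, ← List.rotate_rotate, List.zip,
    ← List.zipWith_rotate_distrib _ _ _ _ (by simp), List.mem_rotate]

theorem eq_of_isChain_rightUnique {R : V → V → Prop} (hR : ∀ x y z, R x y → R x z → y = z)
    {s s' : List V} (h : (x :: s ++ [v]).IsChain R) (h' : (x :: s' ++ [v]).IsChain R)
    (hv : v ∉ s) (hv' : v ∉ s') : s = s' := by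
  induction s generalizing x s' with
  | nil =>
    cases s' with
    | nil => rfl
    | cons b s' => 
      simp at h h'
      simp [hR _ _ _ h h'.1] at hv'
  | cons a s ih =>
    cases s' with
    | nil =>
      simp at h h'
      simp [hR _ _ _ h' h.1] at hv
    | cons b s' =>
      simp only [List.cons_append, List.isChain_cons_cons] at h h'
      obtain rfl := hR _ _ _ h.1 h'.1
      simp only [List.mem_cons, not_or] at hv hv'
      rw [ih h.2 h'.2 hv.2 hv'.2]

theorem cycleArcs_rightUnique {a : V} {t : List V} (hn : (a :: t).Nodup)
    (h : (x, y) ∈ cycleArcs (a :: t)) (h' : (x, z) ∈ cycleArcs (a :: t)) : y = z := by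
  rw [cycleArcs_cons, Set.mem_ofPred_eq, mem_pathArcs] at h h'
  obtain ⟨p, s, h⟩ := h
  obtain ⟨p', s', h'⟩ := h'
  obtain ⟨c, e, hc⟩ := (List.eq_nil_or_concat' (y :: s)).resolve_left (by simp)
  obtain ⟨c', e', hc'⟩ := (List.eq_nil_or_concat' (z :: s')).resolve_left (by simp)
  rw [hc, ← List.cons_append, ← List.append_assoc] at h
  rw [hc', ← List.cons_append, ← List.append_assoc] at h'
  obtain ⟨h1, h2⟩ := List.append_inj' h rfl
  obtain ⟨h1', h2'⟩ := List.append_inj' h' rfl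
  rw [h1] at hn
  obtain ⟨-, h3⟩ := append_cons_inj_of_nodup hn (h1.symm.trans h1')
  have : y :: s = z :: s' := by
    rw [hc, hc', h3]
    simp at h2 h2'
    rw [← h2, ← h2']
  simpa using (List.cons.inj this).1

/-- Each vertex of a cycle has only one successor in the arc set, so following arcs from a fixed
first vertex recovers the list. This turns uniqueness of cycles into uniqueness of paths. -/
theorem eq_of_cycleArcs_eq {a : V} {t t' : List V} (hn : (a :: t).Nodup) (hn' : (a :: t').Nodup)
    (h : cycleArcs (a :: t) = cycleArcs (a :: t')) : t = t' := by
  have key : ∀ s : List V, (a :: s ++ [a]).IsChain (fun x y => (x, y) ∈ cycleArcs (a :: s)) := by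
    intro s
    rw [List.isChain_iff_forall_rel_of_append_cons_cons]
    intro x y p r hp
    rw [cycleArcs_cons, Set.mem_ofPred_eq, mem_pathArcs]
    exact ⟨p, r, hp⟩
  refine eq_of_isChain_rightUnique (R := fun x y => (x, y) ∈ cycleArcs (a :: t)) (x := a) (v := a)
    (fun x y z => cycleArcs_rightUnique hn) (key t) ?_ (by simp_all) (by simp_all)
  rw [h]
  exact key t'

/-! ### Directed paths -/

namespace IsDirPath

theorem nodup (h : IsDirPath D u v l) : l.Nodup := h.2.2.1

theorem ne_nil (h : IsDirPath D u v l) : l ≠ [] := by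
  rintro rfl; simpa using h.1

theorem head_mem (h : IsDirPath D u v l) : u ∈ l := List.mem_of_mem_head? (by simp [h.1])

theorem last_mem (h : IsDirPath D u v l) : v ∈ l := List.mem_of_getLast? h.2.1

theorem exists_cons (h : IsDirPath D u v l) : ∃ t, l = u :: t := by
  obtain ⟨h1, -⟩ := h
  cases l with
  | nil => simp at h1
  | cons a t => simp at h1; exact ⟨t, by rw [h1]⟩

theorem exists_concat (h : IsDirPath D u v l) : ∃ t, l = t ++ [v] := by
  obtain ⟨-, h1, -⟩ := h
  exact List.getLast?_eq_some_iff.1 h1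

theorem singleton (D : Digraph V) (u : V) : IsDirPath D u u [u] := by simp [IsDirPath]

theorem eq_singleton (h : IsDirPath D u u l) : l = [u] := by
  obtain ⟨t, rfl⟩ := h.exists_cons
  cases t with
  | nil => rfl
  | cons a t =>
    have h1 := h.2.1
    have h2 := h.nodup
    rw [List.getLast?_cons_cons] at h1
    exact absurd (List.mem_of_getLast? h1) (List.nodup_cons.1 h2).1

theorem reverse (h : IsDirPath D u v l) : IsDirPath ⟨flip D.Adj⟩ v u l.reverse := by
  obtain ⟨h1, h2, h3, h4⟩ := h
  exact ⟨by simpa, by simpa, by simpa, List.isChain_reverse.2 h4⟩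

theorem upTo (h : IsDirPath D u v (l₁ ++ x :: l₂)) : IsDirPath D u x (l₁ ++ [x]) := by
  obtain ⟨h1, h2, h3, h4⟩ := h
  refine ⟨?_, by simp, ?_, ?_⟩
  · cases l₁ <;> simp_all
  · exact h3.sublist (by simp)
  · exact (List.isChain_split.1 h4).1

theorem onFrom (h : IsDirPath D u v (l₁ ++ x :: l₂)) : IsDirPath D x v (x :: l₂) := by
  obtain ⟨h1, h2, h3, h4⟩ := h
  refine ⟨by simp, ?_, ?_, ?_⟩
  · rw [List.getLast?_append] at h2
    simpa using h2
  · exact h3.sublist (by simp)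
  · exact (List.isChain_split.1 h4).2

theorem append (h₁ : IsDirPath D u v l₁) (h₂ : IsDirPath D x y l₂) (h : D.Adj v x)
    (hd : ∀ z ∈ l₁, z ∉ l₂) : IsDirPath D u y (l₁ ++ l₂) := by
  refine ⟨?_, ?_, ?_, ?_⟩
  · rw [List.head?_append, h₁.1]; rfl
  · rw [List.getLast?_append, h₂.2.1]; rfl
  · rw [List.nodup_append]
    exact ⟨h₁.nodup, h₂.nodup, fun a ha b hb hab => hd a ha (hab ▸ hb)⟩
  · refine List.IsChain.append h₁.2.2.2 h₂.2.2.2 ?_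
    simp [h₁.2.1, h₂.1, h]

theorem concat (h₁ : IsDirPath D u v l) (h : D.Adj v x) (hx : x ∉ l) :
    IsDirPath D u x (l ++ [x]) :=
  h₁.append (singleton D x) h (by rintro z hz; simp; rintro rfl; exact hx hz)

theorem adj (h : IsDirPath D u v (l₁ ++ x :: y :: l₂)) : D.Adj x y := by
  have := h.2.2.2
  rw [List.isChain_iff_forall_rel_of_append_cons_cons] at this
  exact this rfl

/-- A path whose first vertex is in `S` and whose last vertex is not has an arc leaving `S`. -/
theorem exists_exit {S : Set V} (h : IsDirPath D u v l) (hu : u ∈ S) (hv : v ∉ S) :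
    ∃ p s x y, l = p ++ x :: y :: s ∧ x ∈ S ∧ y ∉ S := by
  induction l generalizing u with
  | nil => exact absurd rfl h.ne_nil
  | cons a t ih =>
    obtain ⟨t', ht⟩ := h.exists_cons
    obtain ⟨rfl, rfl⟩ := List.cons.inj ht
    cases t with
    | nil =>
      have := h.2.1
      simp at this
      exact absurd (this ▸ hu) hv
    | cons b t =>
      by_cases hb : b ∈ S
      · obtain ⟨p, s, x, y, h1, h2⟩ := ih (onFrom (l₁ := [a]) h) hb
        exact ⟨a :: p, s, x, y, by simp [h1], h2⟩
      · exact ⟨[], t, a, b, rfl, hu, hb⟩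

end IsDirPath

/-! ### Uniqueness of paths in cacti -/

/-- Every ordered pair of vertices is joined by exactly one directed path. -/
def HasUniquePaths (D : Digraph V) : Prop := ∀ u v, ∃! l, IsDirPath D u v l

/-- Asymmetry excludes loops and pairs of opposite arcs, so the closed walk has the required 3
vertices. -/
theorem IsDirPath.isDirCycle (ho : IsOrientedGraph D) (h : IsDirPath D v u l) (ha : D.Adj u v) :
    IsDirCycle D (cycleArcs l) ∧ (u, v) ∈ cycleArcs l := by
  obtain ⟨t, rfl⟩ := h.exists_cons
  have hmem : (u, v) ∈ cycleArcs (v :: t) := by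
    rw [cycleArcs_cons, Set.mem_ofPred_eq, mem_pathArcs]
    obtain ⟨s, hs⟩ := h.exists_concat
    exact ⟨s, [], by rw [hs]; simp⟩
  refine ⟨⟨v :: t, ?_, h.nodup, rfl, ?_⟩, hmem⟩
  · match t, h with
    | [], h =>
      have := h.2.1
      simp at this
      subst this
      exact absurd ha (ho _ _ ha)
    | [b], h =>
      have := h.2.1
      simp at this
      subst this
      exact absurd (h.adj (l₁ := []) (l₂ := [])) (ho _ _ ha)
    | b :: c :: t, h => simp
  · rintro ⟨x, y⟩ hp
    rw [cycleArcs_cons, Set.mem_ofPred_eq, mem_pathArcs] at hp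
    obtain ⟨p, s, hp⟩ := hp
    have hc : (v :: t ++ [v]).IsChain D.Adj := by
      refine List.IsChain.append h.2.2.2 (by simp) ?_
      simp [h.2.1, ha]
    rw [List.isChain_iff_forall_rel_of_append_cons_cons] at hc
    exact hc hp

/-- A directed cycle through the arc `uv` consists of this arc and a path from `v` to `u`. -/
theorem IsDirCycle.exists_isDirPath {C : Set (V × V)} (h : IsDirCycle D C) (ha : (u, v) ∈ C) :
    ∃ l, IsDirPath D v u l ∧ C = cycleArcs l := by
  obtain ⟨l, h3, hn, rfl, hadj⟩ := h
  -- Rotate the cycle so that it starts at `v`; then its last vertex is `u`.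
  have : ∃ k t, l.rotate k = v :: t ∧ (v :: t).getLast? = some u := by
    cases l with
    | nil => simp at h3
    | cons a t =>
      have ha' := ha
      rw [cycleArcs_cons, Set.mem_ofPred_eq, mem_pathArcs] at ha'
      obtain ⟨p, s, hp⟩ := ha'
      rcases List.eq_nil_or_concat' s with rfl | ⟨s, b, rfl⟩
      · rw [show p ++ [u, v] = (p ++ [u]) ++ [v] by simp] at hp
        obtain ⟨h1, h2⟩ := List.append_inj' hp rfl
        obtain rfl := (List.cons.inj h2).1
        exact ⟨0, t, by simp, by rw [h1]; simp⟩
      · rw [show p ++ u :: v :: (s ++ [b]) = (p ++ u :: v :: s) ++ [b] by simp] at hp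
        obtain ⟨h1, h2⟩ := List.append_inj' hp rfl
        refine ⟨(p ++ [u]).length, s ++ (p ++ [u]), ?_, ?_⟩
        · rw [h1, show p ++ u :: v :: s = (p ++ [u]) ++ v :: s by simp,
            List.rotate_append_length_eq]
          simp
        · rw [show v :: (s ++ (p ++ [u])) = (v :: s ++ p) ++ [u] by simp, List.getLast?_append]
          rfl
  obtain ⟨k, t, hk, hl⟩ := this
  have hC : cycleArcs (v :: t) = cycleArcs l := by rw [← hk, cycleArcs_rotate]
  refine ⟨v :: t, ⟨by simp, hl, ?_, ?_⟩, hC.symm⟩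
  · rw [← hk]; exact List.nodup_rotate.2 hn
  · rw [List.isChain_iff_forall_rel_of_append_cons_cons]
    intro x y p s hp
    refine hadj (x, y) ?_
    rw [← hC, cycleArcs_cons, Set.mem_ofPred_eq, mem_pathArcs]
    exact ⟨p, s ++ [v], by rw [hp]; simp⟩

theorem HasUniquePaths.isCactus (h : HasUniquePaths D) (ho : IsOrientedGraph D) : IsCactus D := by
  refine ⟨fun u v => (h u v).exists, ho, fun u v ha => ?_⟩
  obtain ⟨l, hl, hu⟩ := h v u
  refine ⟨cycleArcs l, hl.isDirCycle ho ha, ?_⟩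
  rintro C ⟨hC, hm⟩
  obtain ⟨l', hl', rfl⟩ := hC.exists_isDirPath hm
  rw [hu l' hl']

/-- For an arc `uv`, two paths from `v` back to `u` would give two cycles through `uv`. For general
`x`, `z`, induct on a path `b` from `z` back to `x`. If `s` follows `z` on `b`, then paths from `x`
to `s` are unique by induction, and paths from `s` to `z` are unique because `zs` is an arc. Two
paths from `x` to `z` are compared by cutting them at `s` or extending them to `s`. -/
theorem IsCactus.hasUniquePaths (h : IsCactus D) : HasUniquePaths D := by
  obtain ⟨hs, ho, hc⟩ := h
  have hback : ∀ u v, D.Adj u v → ∀ l l', IsDirPath D v u l → IsDirPath D v u l' → l = l' := by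
    intro u v ha l l' hl hl'
    have := (hc u v ha).unique (hl.isDirCycle ho ha) (hl'.isDirCycle ho ha)
    obtain ⟨t, rfl⟩ := hl.exists_cons
    obtain ⟨t', rfl⟩ := hl'.exists_cons
    rw [eq_of_cycleArcs_eq hl.nodup hl'.nodup this]
  have key : ∀ b : List V, ∀ x z, IsDirPath D z x b → ∀ r r', IsDirPath D x z r →
      IsDirPath D x z r' → r = r' := by
    intro b
    induction b with
    | nil => intro x z h; exact absurd rfl h.ne_nil
    | cons a t ih =>
      intro x z hb r r' hr hr'
      obtain ⟨t', ht⟩ := hb.exists_cons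
      obtain ⟨rfl, rfl⟩ := List.cons.inj ht
      cases t with
      | nil =>
        have := hb.2.1
        simp at this
        subst this
        rw [hr.eq_singleton, hr'.eq_singleton]
      | cons s t =>
        have hst := IsDirPath.onFrom (l₁ := [a]) hb
        have has : D.Adj a s := hb.adj (l₁ := [])
        -- If only `r` meets `s`, its part up to `s` equals `r'` followed by `s`, so `r` visits `a`
        -- before `s` and again at its end.
        have mixed : ∀ r r', IsDirPath D x a r → IsDirPath D x a r' → s ∈ r → s ∉ r' → False := by
          intro r r' hr hr' h1 h2
          obtain ⟨p, q, rfl⟩ := List.append_of_mem h1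
          have e := ih x s hst _ _ hr.upTo (hr'.concat has h2)
          obtain ⟨e1, -⟩ := List.append_inj' e rfl
          subst e1
          have := hr.nodup
          rw [List.nodup_append] at this
          have hl := hr.onFrom.last_mem
          exact this.2.2 a hr'.last_mem a hl rfl
        by_cases h1 : s ∈ r <;> by_cases h2 : s ∈ r'
        · obtain ⟨p, q, rfl⟩ := List.append_of_mem h1
          obtain ⟨p', q', rfl⟩ := List.append_of_mem h2
          have e := ih x s hst _ _ hr.upTo hr'.upTo
          have e' := hback a s has _ _ hr.onFrom hr'.onFrom
          obtain ⟨e1, -⟩ := List.append_inj' e rfl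
          rw [e1, e']
        · exact (mixed r r' hr hr' h1 h2).elim
        · exact (mixed r' r hr' hr h2 h1).elim
        · exact (List.append_inj' (ih x s hst _ _ (hr.concat has h1) (hr'.concat has h2)) rfl).1
  intro u v
  obtain ⟨l, hl⟩ := hs u v
  obtain ⟨b, hb⟩ := hs v u
  exact ⟨l, hl, fun l' hl' => key b u v hb l' l hl' hl⟩

end RainbowDigraph

namespace RainbowDigraph

variable {V : Type*} {D : Digraph V} {u v w x y z a b : V} {l l₁ l₂ : List V}

/-! ### Bounds for the rainbow connection numbers -/

theorem map_fst_pathArcs (l : List V) : (pathArcs l).map Prod.fst = l.dropLast := by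
  unfold pathArcs
  induction l with
  | nil => rfl
  | cons a t ih =>
    cases t with
    | nil => rfl
    | cons b t => simpa using ih

theorem mem_dropLast_of_mem_internalVertices (h : x ∈ internalVertices l) : x ∈ l.dropLast := by
  cases l with
  | nil => simp [internalVertices] at h
  | cons a t =>
    cases t with
    | nil => simp [internalVertices] at h
    | cons b t => simp_all [internalVertices]

theorem mem_tail_of_mem_internalVertices (h : x ∈ internalVertices l) : x ∈ l.tail :=
  List.mem_of_mem_dropLast h

theorem IsDirPath.nodup_internalVertices (h : IsDirPath D u v l) : (internalVertices l).Nodup :=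
  h.nodup.sublist ((List.dropLast_sublist _).trans (List.tail_sublist _))

/-- The two palettes are kept disjoint, so vertices and arcs never conflict. The tails of the arcs
of a path are all its vertices but the last, which is why `g` need only be injective on
`l.dropLast`. -/
theorem exists_isTotalRainbowConnected (hs : IsStronglyConnected D) {β γ : Type*}
    (f : V → β) (g : V → γ) (F : Finset β) (G : Finset γ) (hF : ∀ x, f x ∈ F) (hG : ∀ x, g x ∈ G)
    (hf : ∀ u v l, IsDirPath D u v l → Set.InjOn f {x | x ∈ internalVertices l})
    (hg : ∀ u v l, IsDirPath D u v l → Set.InjOn g {x | x ∈ l.dropLast}) :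
    ∃ (cV : V → Fin (F.card + G.card)) (cA : V × V → Fin (F.card + G.card)),
      IsTotalRainbowConnected D cV cA := by
  let e : F ⊕ G ≃ Fin (F.card + G.card) := Fintype.equivFinOfCardEq (by simp)
  refine ⟨fun x => e (Sum.inl ⟨f x, hF x⟩), fun p => e (Sum.inr ⟨g p.1, hG p.1⟩), fun u v => ?_⟩
  obtain ⟨l, hl⟩ := hs u v
  refine ⟨l, hl, ?_⟩
  unfold IsTotalRainbow
  rw [show (fun p : V × V => e (Sum.inr ⟨g p.1, hG p.1⟩))
    = (fun x => e (Sum.inr ⟨g x, hG x⟩)) ∘ Prod.fst from rfl, ← List.map_map, map_fst_pathArcs,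
    List.nodup_append]
  refine ⟨?_, ?_, ?_⟩
  · refine List.Nodup.map_on ?_ hl.nodup_internalVertices
    intro x hx y hy h
    simp only [EmbeddingLike.apply_eq_iff_eq, Sum.inl.injEq, Subtype.mk.injEq] at h
    exact hf u v l hl hx hy h
  · refine List.Nodup.map_on ?_ (hl.nodup.sublist (List.dropLast_sublist _))
    intro x hx y hy h
    simp only [EmbeddingLike.apply_eq_iff_eq, Sum.inr.injEq, Subtype.mk.injEq] at h
    exact hg u v l hl hx hy h
  · intro a ha b hb
    obtain ⟨x, -, rfl⟩ := List.mem_map.1 ha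
    obtain ⟨y, -, rfl⟩ := List.mem_map.1 hb
    simp

/-- An upper bound for `trc` from a vertex colouring `f` and an arc colouring that colours every
arc `xy` by `g x`. -/
theorem trc_le (hs : IsStronglyConnected D) {β γ : Type*}
    (f : V → β) (g : V → γ) (F : Finset β) (G : Finset γ) (hF : ∀ x, f x ∈ F) (hG : ∀ x, g x ∈ G)
    (hf : ∀ u v l, IsDirPath D u v l → Set.InjOn f {x | x ∈ internalVertices l})
    (hg : ∀ u v l, IsDirPath D u v l → Set.InjOn g {x | x ∈ l.dropLast}) :
    trc D ≤ F.card + G.card :=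
  Nat.sInf_le (exists_isTotalRainbowConnected hs f g F G hF hG hf hg)

theorem exists_isRainbowVertexConnected (hs : IsStronglyConnected D) {β : Type*}
    (f : V → β) (F : Finset β) (hF : ∀ x, f x ∈ F)
    (hf : ∀ u v l, IsDirPath D u v l → Set.InjOn f {x | x ∈ internalVertices l}) :
    ∃ c : V → Fin F.card, IsRainbowVertexConnected D c := by
  let e : F ≃ Fin F.card := Fintype.equivFinOfCardEq (by simp)
  refine ⟨fun x => e ⟨f x, hF x⟩, fun u v => ?_⟩
  obtain ⟨l, hl⟩ := hs u v
  refine ⟨l, hl, List.Nodup.map_on ?_ hl.nodup_internalVertices⟩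
  intro x hx y hy h
  simp only [EmbeddingLike.apply_eq_iff_eq, Subtype.mk.injEq] at h
  exact hf u v l hl hx hy h

theorem rvc_le (hs : IsStronglyConnected D) {β : Type*}
    (f : V → β) (F : Finset β) (hF : ∀ x, f x ∈ F)
    (hf : ∀ u v l, IsDirPath D u v l → Set.InjOn f {x | x ∈ internalVertices l}) :
    rvc D ≤ F.card :=
  Nat.sInf_le (exists_isRainbowVertexConnected hs f F hF hf)

theorem le_trc [Fintype V] (hs : IsStronglyConnected D) {N : ℕ}
    (h : ∀ k (cV : V → Fin k) (cA : V × V → Fin k), IsTotalRainbowConnected D cV cA → N ≤ k) :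
    N ≤ trc D := by
  -- Giving every vertex and every tail its own colour shows that the set is nonempty, so that
  -- `sInf` is a true minimum and not the default value 0.
  refine le_csInf ⟨_, exists_isTotalRainbowConnected hs id id Finset.univ Finset.univ (by simp)
    (by simp) (by simp) (by simp)⟩ ?_
  rintro k ⟨cV, cA, hk⟩
  exact h k cV cA hk

theorem le_rvc [Fintype V] (hs : IsStronglyConnected D) {N : ℕ}
    (h : ∀ k (c : V → Fin k), IsRainbowVertexConnected D c → N ≤ k) : N ≤ rvc D := by
  refine le_csInf ⟨_, exists_isRainbowVertexConnected hs id Finset.univ (by simp) (by simp)⟩ ?_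
  rintro k ⟨c, hk⟩
  exact h k c hk

namespace HasUniquePaths

theorem stronglyConnected (h : HasUniquePaths D) : IsStronglyConnected D := fun u v => (h u v).exists

theorem eq (h : HasUniquePaths D) (h₁ : IsDirPath D u v l₁) (h₂ : IsDirPath D u v l₂) : l₁ = l₂ :=
  (h u v).unique h₁ h₂

theorem isTotalRainbow {α : Type*} {cV : V → α} {cA : V × V → α} (h : HasUniquePaths D)
    (hc : IsTotalRainbowConnected D cV cA) (hl : IsDirPath D u v l) : IsTotalRainbow cV cA l := by
  obtain ⟨l', hl', hr⟩ := hc u v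
  rwa [h.eq hl hl']

theorem isVertexRainbow {α : Type*} {c : V → α} (h : HasUniquePaths D)
    (hc : IsRainbowVertexConnected D c) (hl : IsDirPath D u v l) : IsVertexRainbow c l := by
  obtain ⟨l', hl', hr⟩ := hc u v
  rwa [h.eq hl hl']

/-- A path with `m ≥ 2` vertices has `m - 2` internal vertices and `m - 1` arcs, and all their
colours differ. -/
theorem length_le_trc [Fintype V] (h : HasUniquePaths D) (hl : IsDirPath D u v l) :
    2 * l.length ≤ trc D + 3 := by
  suffices 2 * l.length - 3 ≤ trc D by omega
  refine le_trc h.stronglyConnected fun k cV cA hk => ?_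
  have h1 := (h.isTotalRainbow hk hl).length_le_card
  simp [internalVertices, pathArcs] at h1
  omega

theorem length_le_rvc [Fintype V] (h : HasUniquePaths D) (hl : IsDirPath D u v l) :
    l.length ≤ rvc D + 2 := by
  suffices l.length - 2 ≤ rvc D by omega
  refine le_rvc h.stronglyConnected fun k c hk => ?_
  have h1 := (h.isVertexRainbow hk hl).length_le_card
  simp [internalVertices] at h1
  omega

theorem flip (h : HasUniquePaths D) : HasUniquePaths ⟨flip D.Adj⟩ := by
  intro u v
  obtain ⟨l, hl, hu⟩ := h v u
  refine ⟨l.reverse, hl.reverse, fun l' hl' => ?_⟩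
  have : l'.reverse = l := hu _ hl'.reverse
  rw [← this, List.reverse_reverse]

/-- The vertex list of the path from `u` to `v`. -/
noncomputable def path (h : HasUniquePaths D) (u v : V) : List V := (h u v).exists.choose

theorem isDirPath_path (h : HasUniquePaths D) (u v : V) : IsDirPath D u v (h.path u v) :=
  (h u v).exists.choose_spec

end HasUniquePaths

/-! ### Leaf cycles -/

/-- `l` is the vertex list of a path from `a` to `b` that is joined to the rest of the digraph
only by the arcs `wa` and `bw`. -/
structure IsLeaf (D : Digraph V) (w a b : V) (l : List V) : Prop where
  path : IsDirPath D a b l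
  ne : a ≠ b
  notMem : w ∉ l
  exit : ∀ x ∈ l, ∀ y, y ∉ l → D.Adj x y → x = b ∧ y = w
  enter : ∀ x, x ∉ l → ∀ y ∈ l, D.Adj x y → x = w ∧ y = a
  eq_of_adj_head : ∀ x, D.Adj x a → x = w
  eq_of_last_adj : ∀ x, D.Adj b x → x = w

namespace IsLeaf

theorem flip (h : IsLeaf D w a b l) : IsLeaf ⟨flip D.Adj⟩ w b a l.reverse where
  path := h.path.reverse
  ne := h.ne.symm
  notMem := by simpa using h.notMem
  exit x hx y hy hxy := (h.enter y (by simpa using hy) x (by simpa using hx) hxy).symm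
  enter x hx y hy hxy := (h.exit y (by simpa using hy) x (by simpa using hx) hxy).symm
  eq_of_adj_head x hx := h.eq_of_last_adj x hx
  eq_of_last_adj x hx := h.eq_of_adj_head x hx

theorem exists_exit (h : IsLeaf D w a b l) {p : List V} (hp : IsDirPath D u v p) (hu : u ∈ l)
    (hv : v ∉ l) : ∃ s t, p = s ++ b :: w :: t := by
  obtain ⟨s, t, x, y, rfl, hx, hy⟩ := hp.exists_exit (S := {x | x ∈ l}) hu hv
  obtain ⟨rfl, rfl⟩ := h.exit x hx y hy hp.adj
  exact ⟨s, t, rfl⟩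

theorem exists_enter (h : IsLeaf D w a b l) {p : List V} (hp : IsDirPath D u v p) (hu : u ∉ l)
    (hv : v ∈ l) : ∃ s t, p = s ++ w :: a :: t := by
  obtain ⟨s, t, x, y, rfl, hx, hy⟩ := hp.exists_exit (S := {x | x ∉ l}) hu (by simpa)
  obtain ⟨rfl, rfl⟩ := h.enter x hx y (by simpa using hy) hp.adj
  exact ⟨s, t, rfl⟩

theorem eq_append (hu : HasUniquePaths D) (h : IsLeaf D w a b l) {p : List V}
    (hp : IsDirPath D a v p) (hv : v ∉ l) : ∃ t, p = l ++ w :: t := by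
  obtain ⟨s, t, rfl⟩ := h.exists_exit hp h.path.head_mem hv
  refine ⟨t, ?_⟩
  rw [hu.eq h.path hp.upTo]
  simp

theorem eq_append' (hu : HasUniquePaths D) (h : IsLeaf D w a b l) {p : List V}
    (hp : IsDirPath D u b p) (hv : u ∉ l) : ∃ t, p = t ++ w :: l := by
  obtain ⟨s, t, rfl⟩ := h.exists_enter hp hv h.path.last_mem
  refine ⟨s, ?_⟩
  rw [show s ++ w :: a :: t = (s ++ [w]) ++ a :: t by simp] at hp
  rw [hu.eq h.path hp.onFrom]

end IsLeaf

/-- No path leaves both `x` and `y`. -/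
def NeverBothLeft (D : Digraph V) (x y : V) : Prop :=
  ∀ u v l, IsDirPath D u v l → x ∈ l.dropLast → y ∉ l.dropLast

/-- No path enters both `x` and `y`. -/
def NeverBothEntered (D : Digraph V) (x y : V) : Prop :=
  ∀ u v l, IsDirPath D u v l → x ∈ l.tail → y ∉ l.tail

theorem NeverBothLeft.symm (h : NeverBothLeft D x y) : NeverBothLeft D y x :=
  fun u v l hl h1 h2 => h u v l hl h2 h1

theorem NeverBothEntered.symm (h : NeverBothEntered D x y) : NeverBothEntered D y x :=
  fun u v l hl h1 h2 => h u v l hl h2 h1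

theorem NeverBothLeft.of_flip (h : NeverBothLeft ⟨flip D.Adj⟩ x y) : NeverBothEntered D x y := by
  intro u v l hl h1 h2
  refine h _ _ _ hl.reverse ?_ ?_ <;> simpa

theorem exists_of_mem_dropLast (h : x ∈ l.dropLast) : ∃ s y t, l = s ++ x :: y :: t := by
  obtain ⟨s, t, ht⟩ := List.append_of_mem h
  have hne : l ≠ [] := by rintro rfl; simp at h
  have := List.dropLast_append_getLast hne
  rw [ht] at this
  cases t with
  | nil => exact ⟨s, l.getLast hne, [], by simpa using this.symm⟩
  | cons y t => exact ⟨s, y, t ++ [l.getLast hne], by simpa using this.symm⟩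

/-- A path that leaves `b` goes on to `w`. If `x` comes earlier, the path must have entered the leaf
through `w`, so `w` is repeated. If `x` comes later, the path has run from `w` to `x`, and by `H`
the vertex after `x` has been visited already. -/
theorem IsLeaf.neverBothLeft (hu : HasUniquePaths D) (h : IsLeaf D w a b l) (hx : x ∉ l)
    (H : ∀ y, D.Adj x y → y ∈ hu.path w x) : NeverBothLeft D x b := by
  intro u v p hp h1 h2
  obtain ⟨s, y, t, hy⟩ := exists_of_mem_dropLast h1
  obtain ⟨s', c, t', hc⟩ := exists_of_mem_dropLast h2
  have hcw : c = w := h.eq_of_last_adj c (by rw [hc] at hp; exact hp.adj)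
  subst hcw
  have hxb : x ≠ b := by rintro rfl; exact hx h.path.last_mem
  have hnd := hp.nodup
  have hxp : x ∈ p := by simp [hy]
  rw [hc] at hxp
  simp only [List.mem_append, List.mem_cons, hxb, false_or] at hxp
  rcases hxp with hxs | hxt
  · obtain ⟨s₁, s₂, rfl⟩ := List.append_of_mem hxs
    have hseg : IsDirPath D x b (x :: s₂ ++ [b]) := by
      rw [hc, show s₁ ++ x :: s₂ ++ b :: c :: t' = (s₁ ++ x :: s₂) ++ b :: (c :: t') by simp] at hp
      have := hp.upTo
      rw [show s₁ ++ x :: s₂ ++ [b] = s₁ ++ x :: (s₂ ++ [b]) by simp] at this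
      exact this.onFrom
    obtain ⟨q, q', hq⟩ := h.exists_enter hseg hx h.path.last_mem
    have hcm : c ∈ x :: s₂ ++ [b] := by simp [hq]
    rw [hc, show s₁ ++ x :: s₂ ++ b :: c :: t' = s₁ ++ (x :: s₂ ++ [b]) ++ c :: t' by simp,
      List.nodup_append] at hnd
    exact hnd.2.2 c (by simp only [List.mem_append]; right; simpa [or_assoc] using hcm) c (by simp) rfl
  · have hw : x ∈ c :: t' := by simpa using hxt
    obtain ⟨s₁, s₂, hs⟩ := List.append_of_mem hw
    have hc2 : p = (s' ++ b :: s₁) ++ x :: s₂ := by rw [hc, hs]; simp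
    obtain ⟨-, e⟩ := append_cons_inj_of_nodup (hy ▸ hnd) (hy.symm.trans hc2)
    subst e
    have hseg : IsDirPath D c x (s₁ ++ [x]) := by
      rw [hc, show s' ++ b :: c :: t' = (s' ++ [b]) ++ c :: t' by simp] at hp
      have := hp.onFrom
      rw [hs] at this
      exact this.upTo
    have hyx : D.Adj x y := by rw [hy] at hp; exact hp.adj
    have hyp := H y hyx
    rw [hu.eq (hu.isDirPath_path c x) hseg] at hyp
    rw [hc2, show s' ++ b :: s₁ ++ x :: y :: t = (s' ++ [b]) ++ (s₁ ++ [x]) ++ y :: t by simp,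
      List.nodup_append] at hnd
    exact hnd.2.2 y (by simp only [List.mem_append]; right; simpa using hyp) y (by simp) rfl

theorem IsLeaf.neverBothLeft_last {w' a' b' : V} {l' : List V} (hu : HasUniquePaths D)
    (h : IsLeaf D w a b l) (h' : IsLeaf D w' a' b' l') (hd : ∀ x ∈ l, x ∉ l') (hw : w ∉ l') :
    NeverBothLeft D b' b := by
  refine h.neverBothLeft hu (fun hb => hd _ hb h'.path.last_mem) fun y hy => ?_
  obtain rfl := h'.eq_of_last_adj y hy
  obtain ⟨s, t, hst⟩ := h'.exists_enter (hu.isDirPath_path w b') hw h'.path.last_mem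
  rw [hst]; simp

/-- Choose `e` off `p` farthest from `w`. If an out-neighbour `y` of `e` were not on the path from
`w` to `e`, the path from `w` to `y` would run through `e`. Then `y` off `p` contradicts maximality.
If `y` is in the leaf, then `e = w`, which is on `p`. If `y` is on the rest of `p`, then so is the
path from `w` to `y`, and with it `e`. -/
theorem IsLeaf.exists_neverBothLeft [Fintype V] (hu : HasUniquePaths D) (h : IsLeaf D w a b l)
    (hv : v ∉ l) {p : List V} (hp : IsDirPath D a v p) (hz : z ∉ p) :
    ∃ e, e ∉ p ∧ NeverBothLeft D e b := by
  classical
  obtain ⟨e, he, hmax⟩ := Finset.exists_max_image (Finset.univ.filter (· ∉ p))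
    (fun z => (hu.path w z).length) ⟨z, by simpa using hz⟩
  simp only [Finset.mem_filter, Finset.mem_univ, true_and] at he hmax
  obtain ⟨t, rfl⟩ := h.eq_append hu hp hv
  simp only [List.mem_append, not_or] at he
  refine ⟨e, by simp [he.1, he.2], h.neverBothLeft hu he.1 fun y hy => ?_⟩
  by_contra hyn
  have hpy := (hu.isDirPath_path w e).concat hy hyn
  have hpy' := hu.eq (hu.isDirPath_path w y) hpy
  by_cases hyp : y ∈ l ++ w :: t
  · rcases List.mem_append.1 hyp with hyl | hyt
    · obtain ⟨rfl, -⟩ := h.enter e he.1 y hyl hy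
      simp at he
    · obtain ⟨s₁, s₂, hs⟩ := List.append_of_mem hyt
      have h1 := hp.onFrom
      rw [hs] at h1
      have h2 := hu.eq h1.upTo hpy
      obtain ⟨h3, -⟩ := List.append_inj' h2 rfl
      refine he.2 ?_
      rw [hs, h3]
      simp [(hu.isDirPath_path w e).last_mem]
  · have := hmax y hyp
    rw [hpy'] at this
    simp at this

/-- In a digraph with unique paths and a vertex of out-degree at least 2, there is a leaf that
avoids a given vertex. -/
theorem exists_isLeaf [Fintype V] (hu : HasUniquePaths D) (ho : IsOrientedGraph D)
    (hb : ∃ w y z, y ≠ z ∧ D.Adj w y ∧ D.Adj w z) (r : V) :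
    ∃ w a b l, IsLeaf D w a b l ∧ r ∉ l ∧ (∃ y z, y ≠ z ∧ D.Adj w y ∧ D.Adj w z) ∧
      ∀ x ∈ l, ∀ y z, D.Adj x y → D.Adj x z → y = z := by
  classical
  -- A branching vertex farthest from `r`: no vertex beyond it branches.
  obtain ⟨w, hw, hmax⟩ := Finset.exists_max_image
    (Finset.univ.filter (fun w => ∃ y z, y ≠ z ∧ D.Adj w y ∧ D.Adj w z))
    (fun z => (hu.path r z).length) (by obtain ⟨w, h⟩ := hb; exact ⟨w, by simpa using h⟩)
  simp only [Finset.mem_filter, Finset.mem_univ, true_and] at hw hmax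
  obtain ⟨t, ht⟩ := (hu.isDirPath_path r w).exists_concat
  have hrw := hu.isDirPath_path r w
  have irr : ∀ x, ¬ D.Adj x x := fun x h => ho _ _ h h
  -- an out-neighbour from which the path back to `w` meets the path from `r` only in `w`
  obtain ⟨a, q, ha, hq, hd⟩ : ∃ a q, D.Adj w a ∧ IsDirPath D a w (q ++ [w]) ∧ ∀ z ∈ q, z ∉ t := by
    -- If the return path from `a` meets the path from `r` before `w`, the two coincide from there
    -- on, so the return path passes through the predecessor `c` of `w`. Two such out-neighbours
    -- would give two paths from `w` to `c`; hence at most one out-neighbour fails.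
    by_contra! hcon
    have key : ∀ a, D.Adj w a → ∃ c s, t.getLast? = some c ∧ IsDirPath D w c (w :: a :: s) := by
      intro a ha
      obtain ⟨q, hq⟩ := (hu.isDirPath_path a w).exists_concat
      have hp := hu.isDirPath_path a w
      rw [hq] at hp
      obtain ⟨z, hzq, hzt⟩ := hcon a q ha hp
      obtain ⟨q₁, q₂, rfl⟩ := List.append_of_mem hzq
      obtain ⟨t₁, t₂, rfl⟩ := List.append_of_mem hzt
      rw [ht] at hrw
      rw [List.append_assoc, List.cons_append] at hrw hp
      have e := hu.eq hrw.onFrom hp.onFrom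
      rw [← List.cons_append, ← List.cons_append] at e
      obtain ⟨e, -⟩ := List.append_inj' e rfl
      obtain ⟨c, s, hc⟩ := (List.eq_nil_or_concat' (z :: q₂)).resolve_left (by simp)
      rw [← List.cons_append, hc, List.append_assoc, ← List.append_assoc] at hp
      have hp' := hp.upTo
      obtain ⟨s', hs'⟩ := hp'.exists_cons
      refine ⟨s, s', by rw [List.getLast?_append, e, hc]; simp, ?_⟩
      rw [← hs', show w :: (q₁ ++ c ++ [s]) = [w] ++ (q₁ ++ c ++ [s]) from rfl]
      refine (IsDirPath.singleton D w).append hp' ha ?_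
      intro x hx hx'
      obtain rfl := List.mem_singleton.1 hx
      have hn := hp.nodup
      rw [show q₁ ++ c ++ ([s] ++ [x]) = (q₁ ++ c ++ [s]) ++ [x] by simp, List.nodup_append] at hn
      exact hn.2.2 x hx' x (by simp) rfl
    obtain ⟨y, z, hyz, hy, hz⟩ := hw
    obtain ⟨c, s, hc, hs⟩ := key y hy
    obtain ⟨c', s', hc', hs'⟩ := key z hz
    obtain rfl : c = c' := by simpa [hc] using hc'
    have := hu.eq hs hs'
    simp at this
    exact hyz this.1
  have hwq : w ∉ q := by
    have := hq.nodup
    rw [List.nodup_append] at this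
    exact fun h => this.2.2 w h w (by simp) rfl
  obtain ⟨q', rfl⟩ : ∃ q', q = a :: q' := by
    obtain ⟨s, hs⟩ := hq.exists_cons
    cases q with
    | nil => simp at hs; exact absurd (hs.1 ▸ ha) (irr _)
    | cons c q => exact ⟨q, by simp at hs; rw [hs.1]⟩
  obtain ⟨q₀, b, hqb⟩ := (List.eq_nil_or_concat' (a :: q')).resolve_left (by simp)
  have hab : IsDirPath D a b (a :: q') := by
    rw [hqb, List.append_assoc] at hq
    rw [hqb]
    exact hq.upTo
  have hbw : D.Adj b w := by
    rw [hqb, List.append_assoc] at hq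
    exact hq.adj
  have hdis : ∀ x ∈ hu.path r w, x ∉ a :: q' := by
    intro x hx hx'
    rw [ht] at hx
    rcases List.mem_append.1 hx with hx | hx
    · exact hd x hx' hx
    · rw [List.mem_singleton.1 hx] at hx'; exact hwq hx'
  have hlong := hrw.append hab ha hdis
  -- The path from `r` to `x` runs through `w` and is longer than the one to `w`, so maximality
  -- forbids branching at `x`.
  have out_unique : ∀ x ∈ a :: q', ∀ y z, D.Adj x y → D.Adj x z → y = z := by
    intro x hx y z hy hz
    by_contra hyz
    have h1 := hmax x ⟨y, z, hyz, hy, hz⟩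
    obtain ⟨q₁, q₂, h2⟩ := List.append_of_mem hx
    rw [h2, ← List.append_assoc] at hlong
    rw [hu.eq (hu.isDirPath_path r x) hlong.upTo] at h1
    simp at h1
  have hout : ∀ x ∈ a :: q', ∀ y, D.Adj x y → ∃ p s, a :: q' ++ [w] = p ++ x :: y :: s := by
    intro x hx y hy
    obtain ⟨q₁, q₂, h2⟩ := List.append_of_mem hx
    rw [h2, List.append_assoc, List.cons_append]
    rw [h2, List.append_assoc, List.cons_append] at hq
    obtain ⟨y', s, hs⟩ : ∃ y' s, q₂ ++ [w] = y' :: s := by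
      cases q₂ with
      | nil => exact ⟨w, [], rfl⟩
      | cons c q₂ => exact ⟨c, q₂ ++ [w], rfl⟩
    rw [hs] at hq ⊢
    rw [out_unique x hx y y' hy hq.adj]
    exact ⟨q₁, s, rfl⟩
  have hout' : ∀ x ∈ a :: q', ∀ y, y ∉ a :: q' → D.Adj x y → y = w := by
    intro x hx y hy hxy
    obtain ⟨p, s, hps⟩ := hout x hx y hxy
    have : y ∈ a :: q' ++ [w] := by rw [hps]; simp
    simpa [hy] using List.mem_append.1 this
  have hin : ∀ x ∈ a :: q', ∀ y, D.Adj y x → ∃ p s, w :: a :: q' = p ++ y :: x :: s := by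
    intro x hx y hyx
    have hxw : x ≠ w := by rintro rfl; exact hwq hx
    by_cases hy : y ∈ a :: q'
    · obtain ⟨p, s, hps⟩ := hout y hy x hyx
      rcases List.eq_nil_or_concat' s with rfl | ⟨s, c, rfl⟩
      · rw [show p ++ [y, x] = (p ++ [y]) ++ [x] by simp] at hps
        have := (List.append_inj' hps rfl).2
        simp at this
        exact absurd this.symm hxw
      · rw [show p ++ y :: x :: (s ++ [c]) = (p ++ y :: x :: s) ++ [c] by simp] at hps
        exact ⟨w :: p, s, by rw [(List.append_inj' hps rfl).1]; rfl⟩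
    -- Here `y` is outside the leaf. If the path from `w` to `y` contains `x`, it has to return to
    -- `w` to get out. Otherwise, extended by `x`, it is the segment of the leaf cycle from `w` to
    -- `x`, which forces `y = w` and `x = a`.
    · have hs := hu.isDirPath_path w y
      obtain ⟨q₁, q₂, h2⟩ := List.append_of_mem hx
      by_cases hxs : x ∈ hu.path w y
      · obtain ⟨s₁, s₂, h3⟩ := List.append_of_mem hxs
        rw [h3] at hs
        obtain ⟨p, p', c, d, hcd, hc, hd⟩ := hs.onFrom.exists_exit (S := {z | z ∈ a :: q'}) hx hy
        have hcd' : D.Adj c d := by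
          have := hs.onFrom
          rw [hcd] at this
          exact this.adj
        obtain rfl := hout' c hc d hd hcd'
        obtain ⟨s₃, h4⟩ := hs.exists_cons
        exfalso
        cases s₁ with
        | nil => simp at h4; exact hxw h4.1
        | cons e s₁ =>
          simp at h4
          obtain rfl := h4.1
          have hn := hs.nodup
          rw [hcd] at hn
          simp at hn
      · have h4 : IsDirPath D w x (w :: q₁ ++ [x]) := by
          rw [h2] at hab
          refine (IsDirPath.singleton D w).append hab.upTo ha ?_
          intro c hc hc'
          obtain rfl := List.mem_singleton.1 hc
          refine hwq ?_
          rw [h2]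
          simp at hc' ⊢
          tauto
        have h5 := (List.append_inj' (hu.eq h4 (hs.concat hyx hxs)) rfl).1
        have h6 := hs.last_mem
        rw [← h5] at h6
        have h7 : y = w := by
          rcases List.mem_cons.1 h6 with h | h
          · exact h
          · exact absurd (by rw [h2]; simp [h]) hy
        subst h7
        rw [hs.eq_singleton] at h5
        simp at h5
        subst h5
        exact ⟨[], q₂, by rw [h2]; rfl⟩
  have hnw : (w :: a :: q').Nodup := List.nodup_cons.2 ⟨hwq, hab.nodup⟩
  refine ⟨w, a, b, a :: q', ⟨hab, ?_, hwq, ?_, ?_, ?_, ?_⟩, ?_, hw, out_unique⟩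
  · rintro rfl
    exact ho _ _ ha hbw
  · intro x hx y hy hxy
    obtain rfl := hout' x hx y hy hxy
    refine ⟨?_, rfl⟩
    obtain ⟨p, s, hps⟩ := hout x hx y hxy
    rw [show p ++ x :: y :: s = (p ++ [x]) ++ y :: s by simp] at hps
    have := (append_cons_inj_of_nodup hq.nodup hps).1
    rw [hqb] at this
    simpa using ((List.append_inj' this rfl).2).symm
  · intro x hx y hy hxy
    obtain ⟨p, s, hps⟩ := hin y hy x hxy
    cases p with
    | nil => simp at hps; exact ⟨hps.1.symm, hps.2.1.symm⟩
    | cons c p =>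
      refine absurd ?_ hx
      rw [(List.cons.inj hps).2]; simp
  · intro x hx
    obtain ⟨p, s, hps⟩ := hin a (by simp) x hx
    rw [show p ++ x :: a :: s = (p ++ [x]) ++ a :: s by simp] at hps
    have := (append_cons_inj_of_nodup (p := [w]) hnw hps).1
    exact (List.append_inj' (s₁ := []) this rfl).2 |> fun h => (List.cons.inj h).1.symm
  · intro x hx
    obtain ⟨p, s, hps⟩ := hout b hab.last_mem x hx
    rw [hqb, List.append_assoc] at hps
    have hn := hq.nodup
    rw [hqb, List.append_assoc] at hn
    have := (append_cons_inj_of_nodup hn hps).2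
    simpa using (List.cons.inj this).1.symm
  · exact hdis r hrw.head_mem

end RainbowDigraph

/-! ### The gap at `2n - 4` -/

namespace RainbowDigraph

variable {V : Type*} {D : Digraph V}

/-- Two vertices can be saved by identifying each of `d`, `a` and each of `d'`, `a'` with
vertices that they are related to. -/
theorem exists_merge [DecidableEq V] {R : V → V → Prop} (hR : ∀ x y, R x y → R y x)
    {a a' d d' : V} (ha : R a a') (hd : R d a') (hd' : R d' a) (h₀ : a ≠ a') (h₁ : d ≠ a)
    (h₂ : d ≠ a') (h₃ : d' ≠ a) (h₄ : d' ≠ a') :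
    ∃ (f : V → V) (S : Finset V), S.card = 2 ∧ S ⊆ {a, a', d, d'} ∧ (∀ x, f x ∉ S) ∧
      (∀ x y, f x = f y → x = y ∨ R x y) ∧ ∀ x, f x = x ∨ f x ∈ ({a, a'} : Finset V) := by
  have ha' := hR _ _ ha
  have hd₁ := hR _ _ hd
  have hd₂ := hR _ _ hd'
  -- If `d = d'`, then `d`, `a`, `a'` are pairwise related and form one class; otherwise the classes
  -- are `{d, a'}` and `{d', a}`. Two colours are saved either way.
  by_cases hdd : d = d'
  · subst hdd
    refine ⟨fun x => if x = d ∨ x = a then a' else x, {d, a}, Finset.card_pair h₁, ?_, ?_, ?_, ?_⟩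
    · intro x; simp; tauto
    · intro x; simp only [Finset.mem_insert, Finset.mem_singleton]; split_ifs <;> grind
    · intro x y; dsimp only; split_ifs <;> grind
    · intro x; dsimp only; split_ifs <;> simp
  · refine ⟨fun x => if x = d then a' else if x = d' then a else x, {d, d'},
      Finset.card_pair hdd, ?_, ?_, ?_, ?_⟩
    · intro x; simp; tauto
    · intro x; simp only [Finset.mem_insert, Finset.mem_singleton]; split_ifs <;> grind
    · intro x y; dsimp only; split_ifs <;> grind
    · intro x; dsimp only; split_ifs <;> simp

/-- Two disjoint leaves decide the matter: either one of the paths from `a` to `b'` and from `a'` to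
`b` is Hamiltonian, or both miss vertices and five colours can be saved. -/
theorem HasUniquePaths.trc_dichotomy [Fintype V] (hu : HasUniquePaths D) (ho : IsOrientedGraph D)
    (hb : ∃ w y z, y ≠ z ∧ D.Adj w y ∧ D.Adj w z) :
    trc D + 5 ≤ 2 * Fintype.card V ∨ 2 * Fintype.card V ≤ trc D + 3 := by
  classical
  obtain ⟨w, a, b, l, hL, -, hw, hlu⟩ := exists_isLeaf hu ho hb hb.choose
  obtain ⟨w', a', b', l', hL', hbl', hw', hlu'⟩ := exists_isLeaf hu ho hb b
  have hwl' : w ∉ l' := by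
    obtain ⟨y, z, hyz, hy, hz⟩ := hw
    exact fun h => hyz (hlu' w h y z hy hz)
  have hwl : w' ∉ l := by
    obtain ⟨y, z, hyz, hy, hz⟩ := hw'
    exact fun h => hyz (hlu w' h y z hy hz)
  -- From a common vertex, the first leaf leads to `b`, which is outside the second, so it passes
  -- through `w'`. But `w'` branches, and no vertex of a leaf does.
  have hdis : ∀ x ∈ l, x ∉ l' := by
    intro x hx hx'
    obtain ⟨s, t, hst⟩ := List.append_of_mem hx
    have hp := hL.path
    rw [hst] at hp
    obtain ⟨p, q, hpq⟩ := hL'.exists_exit hp.onFrom hx' hbl'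
    refine hwl ?_
    rw [hst, hpq]; simp
  have hdis' : ∀ x ∈ l', x ∉ l := fun x h h' => hdis x h' h
  have hb'l : b' ∉ l := hdis' _ hL'.path.last_mem
  have hal' : a ∉ l' := hdis _ hL.path.head_mem
  have ha'l : a' ∉ l := hdis' _ hL'.path.head_mem
  have ham := hL.path.head_mem
  have hbm := hL.path.last_mem
  have ham' := hL'.path.head_mem
  have hbm' := hL'.path.last_mem
  have hp := hu.isDirPath_path a b'
  have hp' := hu.isDirPath_path a' b
  have ne_of_mem_leaves : ∀ x y : V, x ∈ l → y ∈ l' → x ≠ y := fun x y h h' e => hdis x h (e ▸ h')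
  by_cases hP : ∀ z, z ∈ hu.path a b'
  · right
    have h1 := hu.length_le_trc hp
    have h2 : (hu.path a b').length = Fintype.card V := by
      rw [← List.toFinset_card_of_nodup hp.nodup, ← Finset.card_univ]
      congr 1; ext z; simp [hP]
    omega
  by_cases hP' : ∀ z, z ∈ hu.path a' b
  · right
    have h1 := hu.length_le_trc hp'
    have h2 : (hu.path a' b).length = Fintype.card V := by
      rw [← List.toFinset_card_of_nodup hp'.nodup, ← Finset.card_univ]
      congr 1; ext z; simp [hP']
    omega
  left
  push Not at hP hP'
  obtain ⟨z, hz⟩ := hP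
  obtain ⟨z', hz'⟩ := hP'
  obtain ⟨e, he, hea⟩ := hL.exists_neverBothLeft hu hb'l hp hz
  obtain ⟨e', he', hea'⟩ := hL'.exists_neverBothLeft hu hbl' hp' hz'
  obtain ⟨d, hd, hda⟩ := hL'.flip.exists_neverBothLeft (v := a) (p := (hu.path a b').reverse)
    hu.flip (by simpa) hp.reverse (by simpa using hz)
  obtain ⟨d', hd', hda'⟩ := hL.flip.exists_neverBothLeft (v := a') (p := (hu.path a' b).reverse)
    hu.flip (by simpa) hp'.reverse (by simpa using hz')
  rw [List.mem_reverse] at hd hd'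
  have hbb : NeverBothLeft D b' b := hL.neverBothLeft_last hu hL' hdis hwl'
  have haa : NeverBothEntered D a' a :=
    (hL.flip.neverBothLeft_last hu.flip hL'.flip (by simpa) (by simpa)).of_flip
  have hsub : ∀ x, x ∈ l ∨ x ∈ l' → x ∈ hu.path a b' := by
    rintro x (hx | hx)
    · obtain ⟨t, ht⟩ := hL.eq_append hu hp hb'l
      rw [ht]; simp [hx]
    · obtain ⟨t, ht⟩ := hL'.eq_append' hu hp hal'
      rw [ht]; simp [hx]
  have hsub' : ∀ x, x ∈ l ∨ x ∈ l' → x ∈ hu.path a' b := by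
    rintro x (hx | hx)
    · obtain ⟨t, ht⟩ := hL.eq_append' hu hp' ha'l
      rw [ht]; simp [hx]
    · obtain ⟨t, ht⟩ := hL'.eq_append hu hp' hbl'
      rw [ht]; simp [hx]
  have ne_of : ∀ x y, x ∉ hu.path a b' → (y ∈ l ∨ y ∈ l') → x ≠ y :=
    fun x y hx hy h => hx (h ▸ hsub y hy)
  have ne_of' : ∀ x y, x ∉ hu.path a' b → (y ∈ l ∨ y ∈ l') → x ≠ y :=
    fun x y hx hy h => hx (h ▸ hsub' y hy)
  obtain ⟨g, T, hT, -, hgT, hg, -⟩ := exists_merge (R := NeverBothLeft D)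
    (fun _ _ => NeverBothLeft.symm) (a := b) (a' := b') (d := e') (d' := e) hbb.symm hea' hea
    (ne_of_mem_leaves _ _ hbm hbm') (ne_of' _ _ he' (by simp [hbm])) (ne_of' _ _ he' (by simp [hbm']))
    (ne_of _ _ he (by simp [hbm])) (ne_of _ _ he (by simp [hbm']))
  obtain ⟨f, S, hS, hSs, hfS, hf, hfi⟩ := exists_merge (R := NeverBothEntered D)
    (fun _ _ => NeverBothEntered.symm) (a := a) (a' := a') (d := d) (d' := d') haa.symm
    hda.of_flip hda'.of_flip
    (ne_of_mem_leaves _ _ ham ham') (ne_of _ _ hd (by simp [ham])) (ne_of _ _ hd (by simp [ham']))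
    (ne_of' _ _ hd' (by simp [ham])) (ne_of' _ _ hd' (by simp [ham']))
  have hbS : b ∉ S := by
    intro h
    have := hSs h
    simp only [Finset.mem_insert, Finset.mem_singleton] at this
    rcases this with h | h | h | h
    · exact hL.ne h.symm
    · exact ne_of_mem_leaves _ _ hbm ham' h
    · exact ne_of _ _ hd (.inl hbm) h.symm
    · exact ne_of' _ _ hd' (.inl hbm) h.symm
  have hbS' : b' ∉ S := by
    intro h
    have := hSs h
    simp only [Finset.mem_insert, Finset.mem_singleton] at this
    rcases this with h | h | h | h
    · exact ne_of_mem_leaves _ _ ham hbm' h.symm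
    · exact hL'.ne h.symm
    · exact ne_of _ _ hd (.inr hbm') h.symm
    · exact ne_of' _ _ hd' (.inr hbm') h.symm
  have hbb' : b' ≠ b := (ne_of_mem_leaves _ _ hbm hbm').symm
  have hfb : ∀ x, f x = b → x = b := by
    intro x hx
    rcases hfi x with h | h
    · rw [← h, hx]
    · rw [hx] at h
      simp only [Finset.mem_insert, Finset.mem_singleton] at h
      rcases h with h | h
      · exact absurd h.symm hL.ne
      · exact absurd h (ne_of_mem_leaves _ _ hbm ham')
  have hfb' : ∀ x, f x = b' → x = b' := by
    intro x hx
    rcases hfi x with h | h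
    · rw [← h, hx]
    · rw [hx] at h
      simp only [Finset.mem_insert, Finset.mem_singleton] at h
      rcases h with h | h
      · exact absurd h.symm (ne_of_mem_leaves _ _ ham hbm')
      · exact absurd h.symm hL'.ne
  -- The tails use `n - 2` colours. For the vertices, `f` saves two colours and leaves `b` and `b'`
  -- alone in their classes, so identifying `b` with `b'` saves a third: no path leaves both.
  have key := trc_le hu.stronglyConnected (fun x => if x = b then b' else f x) g
    (Finset.univ \ insert b S) (Finset.univ \ T) ?_ (by simpa using hgT) ?_ ?_
  · rw [Finset.card_sdiff_of_subset (Finset.subset_univ _),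
      Finset.card_sdiff_of_subset (Finset.subset_univ _), Finset.card_insert_of_notMem hbS, hS, hT,
      Finset.card_univ] at key
    have := Finset.card_le_univ (insert b S)
    rw [Finset.card_insert_of_notMem hbS, hS] at this
    omega
  · intro x
    simp only [Finset.mem_sdiff, Finset.mem_univ, true_and, Finset.mem_insert, not_or]
    split_ifs with hx
    · exact ⟨hbb', hbS'⟩
    · exact ⟨fun h => hx (hfb x h), hfS x⟩
  · intro u v p hpath x hx y hy hxy
    have hx1 := mem_dropLast_of_mem_internalVertices hx
    have hy1 := mem_dropLast_of_mem_internalVertices hy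
    dsimp only at hxy
    split_ifs at hxy with h1 h2 h2
    · rw [h1, h2]
    · rw [h1] at hx1
      rw [hfb' y hxy.symm] at hy1
      exact absurd hx1 (hbb u v p hpath hy1)
    · rw [h2] at hy1
      rw [hfb' x hxy] at hx1
      exact absurd hy1 (hbb u v p hpath hx1)
    · rcases hf x y hxy with h | h
      · exact h
      · exact absurd (mem_tail_of_mem_internalVertices hy)
          (h u v p hpath (mem_tail_of_mem_internalVertices hx))
  · intro u v p hpath x hx y hy hxy
    rcases hg x y hxy with h | h
    · exact h
    · exact absurd hy (h u v p hpath hx)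

theorem exists_mem_cycleArcs {x : V} {l : List V} (hx : x ∈ l) : ∃ y ∈ l, (x, y) ∈ cycleArcs l := by
  cases l with
  | nil => simp at hx
  | cons a t =>
    obtain ⟨p, s, hps⟩ := List.append_of_mem hx
    have : ∃ y s', s ++ [a] = y :: s' ∧ y ∈ a :: t := by
      cases s with
      | nil => exact ⟨a, [], rfl, by simp⟩
      | cons c s => exact ⟨c, s ++ [a], rfl, by rw [hps]; simp⟩
    obtain ⟨y, s', h, hy⟩ := this
    refine ⟨y, hy, ?_⟩
    rw [cycleArcs_cons, Set.mem_ofPred_eq, mem_pathArcs]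
    exact ⟨p, s', by rw [hps, ← h]; simp⟩

/-- Without branching, no arc leaves the vertex set of the first cycle, which by strong connectivity
contains all vertices. A vertex of the second cycle then has an out-arc in each cycle, and these are
distinct arcs. -/
theorem HasCycleDecomposition.exists_branching {q : ℕ} (hs : IsStronglyConnected D) (hq : 2 ≤ q)
    (h : HasCycleDecomposition D q) : ∃ w y z, y ≠ z ∧ D.Adj w y ∧ D.Adj w z := by
  by_contra! hcon
  obtain ⟨H, hH, hHu⟩ := h
  obtain ⟨l, h3, -, hC, hadj⟩ := hH ⟨0, by omega⟩
  obtain ⟨l', h3', -, hC', hadj'⟩ := hH ⟨1, by omega⟩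
  obtain ⟨v, hv⟩ := List.exists_mem_of_length_pos (l := l) (by omega)
  obtain ⟨x, hx⟩ := List.exists_mem_of_length_pos (l := l') (by omega)
  obtain ⟨y, -, hxy⟩ := exists_mem_cycleArcs hx
  have hxl : x ∈ l := by
    by_contra hxl
    obtain ⟨p, hp⟩ := hs v x
    obtain ⟨s, t, c, d, rfl, hc, hd⟩ := hp.exists_exit (S := {z | z ∈ l}) hv hxl
    obtain ⟨d', hd', hcd⟩ := exists_mem_cycleArcs hc
    have := hadj (c, d') (hC ▸ hcd)
    by_cases hdd : d' = d
    · exact hd (hdd ▸ hd')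
    · exact hcon c d' d hdd this hp.adj
  obtain ⟨y', -, hxy'⟩ := exists_mem_cycleArcs hxl
  rw [← hC] at hxy'
  rw [← hC'] at hxy
  have h1 := hadj _ hxy'
  have h2 := hadj' _ hxy
  by_cases hyy : y = y'
  · subst hyy
    have := (hHu x y h2).unique hxy hxy'
    simp at this
  · exact hcon x y y' hyy h2 h1

theorem trc_ne_of_isNQCactus [Fintype V] {n q : ℕ} (hq : 2 ≤ q) (h : IsNQCactus D n q) :
    (trc D : ℤ) ≠ 2 * n - 4 := by
  obtain ⟨hc, hn, hd⟩ := h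
  have := hc.hasUniquePaths.trc_dichotomy hc.2.1 (hd.exists_branching hc.1 hq)
  omega

end RainbowDigraph

namespace RainbowDigraph

/-! ### Labelled cacti -/

/-- A cactus with vertices `0, …, n - 1` and `q` cycles: `P u v` is the vertex list of the path
from `u` to `v`, and `C i` is the vertex list of the `i`-th cycle. -/
structure LabelledCactus where
  D : Digraph ℕ
  n : ℕ
  q : ℕ
  P : ℕ → ℕ → List ℕ
  C : ℕ → List ℕ
  lt : ∀ {u v}, D.Adj u v → u < n ∧ v < n
  asymm : ∀ {u v}, D.Adj u v → ¬ D.Adj v u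
  path : ∀ {u v}, u < n → v < n → IsDirPath D u v (P u v)
  mem_lt : ∀ {u v z}, u < n → v < n → z ∈ P u v → z < n
  ext : ∀ {u v v'}, u < n → D.Adj v v' → v' ∈ P u v ∨ P u v' = P u v ++ [v']
  cycle : ∀ i < q, 3 ≤ (C i).length ∧ (C i).Nodup ∧ ∀ u v, (u, v) ∈ cycleArcs (C i) → D.Adj u v
  decomp : ∀ {u v}, D.Adj u v → ∃! i, i < q ∧ (u, v) ∈ cycleArcs (C i)

/-- The digraph that arises from `D` by adding a cycle `w, n, n + 1, …, n + m - 1`. -/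
def attachGraph (D : Digraph ℕ) (n w m : ℕ) : Digraph ℕ where
  Adj u v := D.Adj u v ∨ (u = w ∧ v = n) ∨ (n ≤ u ∧ v = u + 1 ∧ v < n + m) ∨
    (n ≤ u ∧ u + 1 = n + m ∧ v = w)

def attachPath (P : ℕ → ℕ → List ℕ) (n w m u v : ℕ) : List ℕ :=
  if u < n then
    if v < n then P u v else P u w ++ List.range' n (v + 1 - n)
  else if v < n then List.range' u (n + m - u) ++ P w v
  else if u ≤ v then List.range' u (v + 1 - u)
  else List.range' u (n + m - u) ++ w :: List.range' n (v + 1 - n)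

variable {D : Digraph ℕ} {n w m u v : ℕ}

theorem isDirPath_range' (hu : n ≤ u) (huv : u ≤ v) (hv : v < n + m) :
    IsDirPath (attachGraph D n w m) u v (List.range' u (v + 1 - u)) := by
  refine ⟨?_, ?_, List.nodup_range', ?_⟩
  · rw [List.head?_range', if_neg (by omega)]
  · rw [List.getLast?_range', if_neg (by omega)]
    congr 1; omega
  · rw [List.isChain_iff_getElem]
    intro i hi
    simp only [List.length_range'] at hi
    simp only [List.getElem_range', attachGraph]
    right; right; left
    omega

theorem mem_cycleArcs_attach {x y : ℕ} :
    (x, y) ∈ cycleArcs (w :: List.range' n m) ↔ (x = w ∧ y = n ∧ 0 < m) ∨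
      (n ≤ x ∧ y = x + 1 ∧ y < n + m) ∨ (n ≤ x ∧ x + 1 = n + m ∧ y = w) ∨
      (m = 0 ∧ x = w ∧ y = w) := by
  cases m with
  | zero => simp [cycleArcs]; omega
  | succ m =>
    rw [cycleArcs_cons, Set.mem_ofPred_eq]
    have key2 : ∀ w n k, (x, y) ∈ pathArcs (w :: List.range' n k) ↔
        (x = w ∧ y = n ∧ 0 < k) ∨ (n ≤ x ∧ y = x + 1 ∧ y < n + k) := by
      intro w n k
      induction k generalizing w n with
      | zero => simp [pathArcs]; omega
      | succ k ih => 
        rw [List.range'_succ]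
        have : (x, y) ∈ pathArcs (w :: n :: List.range' (n + 1) k) ↔
          (x = w ∧ y = n) ∨ (x, y) ∈ pathArcs (n :: List.range' (n + 1) k) := by simp [pathArcs]
        rw [this, ih]
        omega
    rw [List.range'_concat, ← List.cons_append, mem_pathArcs_concat, List.cons_append,
      ← List.range'_concat, key2, Prod.mk.injEq]
    omega

namespace LabelledCactus

variable (F : LabelledCactus)

theorem path_self (hu : u < F.n) : F.P u u = [u] := (F.path hu hu).eq_singleton

/-- Adding a cycle with `m` new vertices at the vertex `w`. -/
def attach (w m : ℕ) (hw : w < F.n) (hm : 2 ≤ m) : LabelledCactus where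
  D := attachGraph F.D F.n w m
  n := F.n + m
  q := F.q + 1
  P := attachPath F.P F.n w m
  C i := if i < F.q then F.C i else w :: List.range' F.n m
  lt := by
    rintro u v (h | h | h | h)
    · have := F.lt h; omega
    all_goals omega
  asymm := by
    rintro u v h h'
    have h1 : F.D.Adj u v → ¬ F.D.Adj v u := F.asymm
    have h2 : F.D.Adj u v → u < F.n ∧ v < F.n := F.lt
    have h3 : F.D.Adj v u → v < F.n ∧ u < F.n := F.lt
    simp only [attachGraph] at h h'
    by_cases c1 : F.D.Adj u v <;> by_cases c2 : F.D.Adj v u <;> 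
      simp only [c1, c2, not_true_eq_false, imp_false, true_imp_iff, true_or, false_or] at * <;>
      omega
  path := by
    intro u v hu hv
    have mono : ∀ {u v l}, IsDirPath F.D u v l → IsDirPath (attachGraph F.D F.n w m) u v l :=
      fun h => ⟨h.1, h.2.1, h.2.2.1, h.2.2.2.imp fun _ _ h => Or.inl h⟩
    unfold attachPath
    split_ifs with h1 h2 h2 h3
    · exact mono (F.path h1 h2)
    · refine (mono (F.path h1 hw)).append (isDirPath_range' le_rfl (by omega) hv)
        (Or.inr (Or.inl ⟨rfl, rfl⟩)) ?_
      intro z hz hz'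
      have := F.mem_lt h1 hw hz
      simp at hz'
      omega
    · have := isDirPath_range' (D := F.D) (n := F.n) (w := w) (m := m) (u := u)
        (v := F.n + m - 1) (by omega) (by omega) (by omega)
      rw [show F.n + m - 1 + 1 - u = F.n + m - u by omega] at this
      refine this.append (mono (F.path hw h2)) (Or.inr (Or.inr (Or.inr ?_))) ?_
      · omega
      · intro z hz hz'
        have := F.mem_lt hw h2 hz'
        simp at hz
        omega
    · exact isDirPath_range' (by omega) h3 hv
    · have := isDirPath_range' (D := F.D) (n := F.n) (w := w) (m := m) (u := u)
        (v := F.n + m - 1) (by omega) (by omega) (by omega)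
      rw [show F.n + m - 1 + 1 - u = F.n + m - u by omega] at this
      refine this.append (((IsDirPath.singleton _ w).append
        (isDirPath_range' (v := v) (m := m) le_rfl (by omega) hv) (Or.inr (Or.inl ⟨rfl, rfl⟩)) ?_))
        (Or.inr (Or.inr (Or.inr ?_))) ?_
      · simp; omega
      · omega
      · simp; omega
  mem_lt := by
    intro u v z hu hv hz
    unfold attachPath at hz
    split_ifs at hz with h1 h2 h2 h3 <;>
      try simp only [List.mem_append, List.mem_range'_1, List.mem_cons] at hz
    · have := F.mem_lt h1 h2 hz; omega
    · rcases hz with hz | hz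
      · have := F.mem_lt h1 hw hz; omega
      · omega
    · rcases hz with hz | hz
      · omega
      · have := F.mem_lt hw h2 hz; omega
    all_goals omega
  ext := by
    intro u v v' hu h
    have hmem : ∀ {a b}, a < F.n → b < F.n → b ∈ F.P a b := fun ha hb => (F.path ha hb).last_mem
    have hmem' : ∀ {a b}, a < F.n → b < F.n → a ∈ F.P a b := fun ha hb => (F.path ha hb).head_mem
    have hww := F.path_self hw
    unfold attachPath
    rcases h with h | ⟨rfl, rfl⟩ | ⟨h1, rfl, h2⟩ | ⟨h1, h2, rfl⟩
    · obtain ⟨hv, hv'⟩ := F.lt h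
      simp only [hv, hv', if_true]
      split_ifs with h1
      · exact F.ext h1 h
      · rcases F.ext hw h with h | h
        · left; simp [h]
        · right; simp [h]
    · simp only [hw, if_true, lt_irrefl, if_false]
      by_cases c1 : u < F.n
      · right; simp [c1]
      · simp only [c1, if_false]
        by_cases c2 : u ≤ F.n
        · left; simp; omega
        · right; simp [c2, hww]
    · have e1 : ¬ v < F.n := by omega
      have e2 : ¬ v + 1 < F.n := by omega
      have e3 : List.range' F.n (v + 1 + 1 - F.n) = List.range' F.n (v + 1 - F.n) ++ [v + 1] := by
        rw [show v + 1 + 1 - F.n = (v + 1 - F.n) + 1 by omega, List.range'_concat]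
        congr 2; omega
      simp only [e1, e2, if_false]
      by_cases c1 : u < F.n
      · right; simp [c1, e3]
      · simp only [c1, if_false]
        by_cases c2 : u ≤ v
        · right
          rw [if_pos c2, if_pos (by omega), show v + 1 + 1 - u = (v + 1 - u) + 1 by omega,
            List.range'_concat]
          congr 2; omega
        · rw [if_neg c2]
          by_cases c3 : u = v + 1
          · left; simp; omega
          · right; rw [if_neg (by omega), e3]; simp
    · have e1 : ¬ v < F.n := by omega
      simp only [e1, hw, if_true, if_false]
      by_cases c1 : u < F.n
      · left; simp [c1, hmem c1 hw]
      · simp only [c1, if_false, hww]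
        split_ifs with c2
        · right; congr 2; omega
        · left; simp
  cycle := by
    intro i hi
    split_ifs with h
    · obtain ⟨h1, h2, h3⟩ := F.cycle i h
      exact ⟨h1, h2, fun u v huv => Or.inl (h3 u v huv)⟩
    · refine ⟨by simp; omega, ?_, ?_⟩
      · simp [List.nodup_range']; omega
      · intro u v huv
        rw [mem_cycleArcs_attach] at huv
        right
        omega
  decomp := by
    intro u v h
    by_cases hD : F.D.Adj u v
    · obtain ⟨i, ⟨hi, hm⟩, hu⟩ := F.decomp hD
      refine ⟨i, ⟨by omega, by simpa [hi]⟩, ?_⟩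
      rintro j ⟨hj, hj'⟩
      split_ifs at hj' with hjq
      · exact hu j ⟨hjq, hj'⟩
      · rw [mem_cycleArcs_attach] at hj'
        have := F.lt hD
        omega
    · have h' : (u, v) ∈ cycleArcs (w :: List.range' F.n m) := by
        rw [mem_cycleArcs_attach]
        simp only [attachGraph, hD, false_or] at h
        omega
      refine ⟨F.q, ⟨by omega, by simpa⟩, ?_⟩
      rintro j ⟨hj, hj'⟩
      split_ifs at hj' with hjq
      · exact absurd ((F.cycle j hjq).2.2 u v hj') hD
      · omega

/-- The digraph with a single vertex. -/
def point : LabelledCactus where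
  D := ⟨fun _ _ => False⟩
  n := 1
  q := 0
  P u _ := [u]
  C _ := []
  lt := by simp
  asymm := by simp
  path := by
    intro u v hu hv
    obtain rfl : u = 0 := by omega
    obtain rfl : v = 0 := by omega
    exact IsDirPath.singleton _ _
  mem_lt := by simp; omega
  ext := by simp
  cycle := by simp
  decomp := by simp

/-- The field `ext` is uniqueness in local form: a path that continues along `P u v` to `v'` either
revisits a vertex or is `P u v'`. Induct on the path from its end. -/
theorem eq_path {l : List ℕ} (hu : u < F.n) (h : IsDirPath F.D u v l) : l = F.P u v := by
  induction l using List.reverseRecOn generalizing v with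
  | nil => exact absurd rfl h.ne_nil
  | append_singleton l c ih =>
    obtain rfl : c = v := by simpa using h.2.1
    rcases List.eq_nil_or_concat' l with rfl | ⟨s, d, rfl⟩
    · obtain rfl : c = u := by simpa using h.1
      rw [F.path_self hu]; rfl
    · have h' := h
      rw [List.append_assoc] at h'
      have hd := h'.adj
      have e := ih h'.upTo
      rcases F.ext hu hd with h1 | h1
      · have := h.nodup
        rw [e, List.nodup_append] at this
        exact absurd rfl (this.2.2 c h1 c (by simp))
      · rw [h1, e]

end LabelledCactus

end RainbowDigraph

/-! ### Criteria for sharing colours, and transfer to `Fin n` -/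

namespace RainbowDigraph

theorem exists_map_val {n : ℕ} {l : List ℕ} (h : ∀ z ∈ l, z < n) :
    ∃ l' : List (Fin n), l'.map Fin.val = l := by
  induction l with
  | nil => exact ⟨[], rfl⟩
  | cons a t ih =>
    obtain ⟨t', ht⟩ := ih fun z hz => h z (by simp [hz])
    exact ⟨⟨a, h a (by simp)⟩ :: t', by simp [ht]⟩

variable {α β : Type*}

theorem internalVertices_map (f : α → β) (l : List α) :
    internalVertices (l.map f) = (internalVertices l).map f := by
  simp [internalVertices, List.map_tail, List.map_dropLast]

theorem pathArcs_map (f : α → β) (l : List α) :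
    pathArcs (l.map f) = (pathArcs l).map (Prod.map f f) := by
  simp [pathArcs, ← List.map_tail, List.zip_map]

theorem mem_cycleArcs_map {f : α → β} (hf : Function.Injective f) {l : List α} {x y : α} :
    (f x, f y) ∈ cycleArcs (l.map f) ↔ (x, y) ∈ cycleArcs l := by
  simp only [cycleArcs, Set.mem_ofPred_eq, ← List.map_rotate, List.zip_map]
  exact List.mem_map_of_injective (Function.Injective.prodMap hf hf) (a := (x, y))

namespace LabelledCactus

variable (F : LabelledCactus) {u v x y : ℕ} {l : List ℕ}

/-- All in-neighbours of `x` are on the path from `x` to `y`. -/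
def Source (x y : ℕ) : Prop := ∀ u, F.D.Adj u x → u ∈ F.P x y

/-- All out-neighbours of `x` are on the path from `y` to `x`. -/
def Sink (x y : ℕ) : Prop := ∀ u, F.D.Adj x u → u ∈ F.P y x

variable {F}

/-- A path that enters `x` comes from an in-neighbour `c`, and going on to `y` it would visit `c`
again. So if two vertices are sources for each other, no path enters both. -/
theorem Source.false_of_append {s t : List ℕ} (h : F.Source x y) (hx : x < F.n)
    (hl : IsDirPath F.D u v (s ++ x :: t)) (hs : s ≠ []) (hy : y ∈ t) : False := by
  obtain ⟨s, c, rfl⟩ := (List.eq_nil_or_concat' s).resolve_left hs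
  obtain ⟨t₁, t₂, rfl⟩ := List.append_of_mem hy
  have h1 := hl
  rw [List.append_assoc] at h1
  have h2 := h c h1.adj
  have h3 := hl.onFrom
  rw [← List.cons_append] at h3
  rw [← F.eq_path hx h3.upTo] at h2
  have hn := hl.nodup
  rw [show s ++ [c] ++ x :: (t₁ ++ y :: t₂) = s ++ c :: (x :: t₁ ++ [y] ++ t₂) by simp] at hn
  have := (List.nodup_append.1 hn).2.1
  rw [List.nodup_cons] at this
  exact this.1 (List.mem_append_left _ h2)

/-- Dually, a path from `x` to `y` has already visited every out-neighbour of `y`, so it cannot go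
on. -/
theorem Sink.false_of_append {s t : List ℕ} (h : F.Sink y x) (hx : x < F.n)
    (hl : IsDirPath F.D u v (s ++ x :: t)) (hy : y ∈ t.dropLast) : False := by
  obtain ⟨t₁, c, t₂, rfl⟩ := exists_of_mem_dropLast hy
  have h1 := hl.onFrom
  rw [← List.cons_append] at h1
  have h2 := h c h1.adj
  rw [← F.eq_path hx h1.upTo] at h2
  have hn := (List.nodup_append.1 hl.nodup).2.1
  rw [show x :: (t₁ ++ y :: c :: t₂) = (x :: t₁ ++ [y]) ++ c :: t₂ by simp, 
    List.nodup_append] at hn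
  exact hn.2.2 c h2 c (by simp) rfl

theorem lt_of_mem (hu : u < F.n) (hv : v < F.n) (hl : IsDirPath F.D u v l) (hx : x ∈ l) :
    x < F.n := F.mem_lt hu hv (F.eq_path hu hl ▸ hx)

theorem eq_of_source (hu : u < F.n) (hv : v < F.n) (hl : IsDirPath F.D u v l) (hx : x ∈ l.tail)
    (hy : y ∈ l.tail) (hxy : F.Source x y) (hyx : F.Source y x) : x = y := by
  by_contra hne
  obtain ⟨t, rfl⟩ := hl.exists_cons
  rw [List.tail_cons] at hx hy
  have hx' := lt_of_mem hu hv hl (List.mem_cons_of_mem _ hx)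
  have hy' := lt_of_mem hu hv hl (List.mem_cons_of_mem _ hy)
  obtain ⟨s, r, rfl⟩ := List.append_of_mem hx
  have hl' := hl
  rw [← List.cons_append] at hl
  rcases List.mem_append.1 hy with h | h
  · obtain ⟨s₁, s₂, rfl⟩ := List.append_of_mem h
    rw [List.append_assoc, List.cons_append, ← List.cons_append] at hl'
    exact hyx.false_of_append hy' hl' (by simp) (by simp)
  · rcases List.mem_cons.1 h with h | h
    · exact hne h.symm
    · exact hxy.false_of_append hx' hl (by simp) h

theorem eq_of_sink (hu : u < F.n) (hv : v < F.n) (hl : IsDirPath F.D u v l) (hx : x ∈ l.dropLast)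
    (hy : y ∈ l.dropLast) (hxy : F.Sink x y) (hyx : F.Sink y x) : x = y := by
  by_contra hne
  obtain ⟨t, rfl⟩ := hl.exists_concat
  rw [List.dropLast_concat] at hx hy
  have hx' := lt_of_mem hu hv hl (List.mem_append_left _ hx)
  have hy' := lt_of_mem hu hv hl (List.mem_append_left _ hy)
  obtain ⟨s, r, rfl⟩ := List.append_of_mem hx
  have hl' := hl
  rw [List.append_assoc, List.cons_append] at hl
  rcases List.mem_append.1 hy with h | h
  · obtain ⟨s₁, s₂, rfl⟩ := List.append_of_mem h
    simp only [List.append_assoc, List.cons_append] at hl'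
    refine hxy.false_of_append hy' hl' ?_
    rw [show s₂ ++ x :: (r ++ [v]) = (s₂ ++ x :: r) ++ [v] by simp, List.dropLast_concat]
    simp
  · rcases List.mem_cons.1 h with h | h
    · exact hne h.symm
    · exact hyx.false_of_append hx' hl (by simpa using h)

variable (F)

/-- The cactus on the vertex set `Fin n`. -/
def graph : Digraph (Fin F.n) := ⟨fun i j => F.D.Adj i j⟩

theorem isDirPath_graph {i j : Fin F.n} {l : List (Fin F.n)} :
    IsDirPath F.graph i j l ↔ IsDirPath F.D i j (l.map Fin.val) := by
  unfold IsDirPath graph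
  rw [List.head?_map, List.getLast?_map, List.nodup_map_iff Fin.val_injective, List.isChain_map]
  have h : ∀ (o : Option (Fin F.n)) (k : Fin F.n), o.map Fin.val = some k.val ↔ o = some k := by
    intro o k
    cases o <;> simp [Fin.ext_iff]
  rw [h, h]

theorem hasUniquePaths : HasUniquePaths F.graph := by
  intro i j
  obtain ⟨l, hl⟩ := exists_map_val (n := F.n) fun z => F.mem_lt i.2 j.2 (z := z)
  refine ⟨l, F.isDirPath_graph.2 (by rw [hl]; exact F.path i.2 j.2), fun l' hl' => ?_⟩
  have := F.eq_path i.2 (F.isDirPath_graph.1 hl')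
  rw [← hl] at this
  exact List.map_injective_iff.2 Fin.val_injective this

theorem isNQCactus : IsNQCactus F.graph F.n F.q := by
  refine ⟨F.hasUniquePaths.isCactus fun u v h => F.asymm h, Fintype.card_fin _, ?_⟩
  have hC : ∀ i : Fin F.q, ∃ l : List (Fin F.n), l.map Fin.val = F.C i := by
    intro i
    refine exists_map_val fun z hz => ?_
    obtain ⟨y, -, hy⟩ := exists_mem_cycleArcs hz
    exact (F.lt ((F.cycle i i.2).2.2 _ _ hy)).1
  choose L hL using hC
  have hmem : ∀ (i : Fin F.q) (x y : Fin F.n),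
      (x, y) ∈ cycleArcs (L i) ↔ (x.val, y.val) ∈ cycleArcs (F.C i) := by
    intro i x y
    rw [← hL, mem_cycleArcs_map Fin.val_injective]
  refine ⟨fun i => cycleArcs (L i), fun i => ?_, fun u v h => ?_⟩
  · obtain ⟨h1, h2, h3⟩ := F.cycle i i.2
    rw [← hL] at h1 h2
    exact ⟨L i, by simpa using h1, h2.of_map, rfl, fun p hp => h3 _ _ ((hmem i _ _).1 hp)⟩
  · obtain ⟨i, ⟨hi, hm⟩, hu⟩ := F.decomp h
    refine ⟨⟨i, hi⟩, (hmem _ _ _).2 hm, fun j hj => ?_⟩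
    exact Fin.ext (hu j ⟨j.2, (hmem _ _ _).1 hj⟩)

variable {F}

/-- Vertices with the same colour are not both internal vertices of a path. -/
def VertexCompatible (F : LabelledCactus) (f : ℕ → ℕ) : Prop :=
  ∀ x < F.n, ∀ y < F.n, f x = f y → x ≠ y →
    (F.Source x y ∧ F.Source y x) ∨ (F.Sink x y ∧ F.Sink y x)

/-- No path leaves two vertices with the same colour. -/
def TailCompatible (F : LabelledCactus) (g : ℕ → ℕ) : Prop :=
  ∀ x < F.n, ∀ y < F.n, g x = g y → x ≠ y → F.Sink x y ∧ F.Sink y x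

theorem VertexCompatible.injOn {f : ℕ → ℕ} (hf : F.VertexCompatible f) (u v : Fin F.n)
    (l : List (Fin F.n)) (hl : IsDirPath F.graph u v l) :
    Set.InjOn (fun i : Fin F.n => f i) {x | x ∈ internalVertices l} := by
  intro x hx y hy hxy
  have hl' := F.isDirPath_graph.1 hl
  have hmem : ∀ z ∈ internalVertices l, z.val ∈ internalVertices (l.map Fin.val) := by
    intro z hz
    rw [internalVertices_map]
    exact List.mem_map_of_mem hz
  have hx' := hmem x hx
  have hy' := hmem y hy
  by_contra hne
  have hne' : x.val ≠ y.val := fun h => hne (Fin.ext h)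
  rcases hf x x.2 y y.2 hxy hne' with ⟨h1, h2⟩ | ⟨h1, h2⟩
  · exact hne' (eq_of_source u.2 v.2 hl' (mem_tail_of_mem_internalVertices hx')
      (mem_tail_of_mem_internalVertices hy') h1 h2)
  · exact hne' (eq_of_sink u.2 v.2 hl' (mem_dropLast_of_mem_internalVertices hx')
      (mem_dropLast_of_mem_internalVertices hy') h1 h2)

theorem TailCompatible.injOn {g : ℕ → ℕ} (hg : F.TailCompatible g) (u v : Fin F.n)
    (l : List (Fin F.n)) (hl : IsDirPath F.graph u v l) :
    Set.InjOn (fun i : Fin F.n => g i) {x | x ∈ l.dropLast} := by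
  intro x hx y hy hxy
  have hmem : ∀ z ∈ l.dropLast, z.val ∈ (l.map Fin.val).dropLast := by
    intro z hz
    rw [← List.map_dropLast]
    exact List.mem_map_of_mem hz
  by_contra hne
  have hne' : x.val ≠ y.val := fun h => hne (Fin.ext h)
  obtain ⟨h1, h2⟩ := hg x x.2 y y.2 hxy hne'
  exact hne' (eq_of_sink u.2 v.2 (F.isDirPath_graph.1 hl) (hmem x hx) (hmem y hy) h1 h2)

theorem rvc_graph_le {f : ℕ → ℕ} {N : ℕ} (hf : F.VertexCompatible f) (hN : ∀ x < F.n, f x < N) :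
    rvc F.graph ≤ N := by
  have := rvc_le F.hasUniquePaths.stronglyConnected (fun i : Fin F.n => f i) (Finset.range N)
    (fun x => by simpa using hN x x.2) hf.injOn
  simpa using this

theorem trc_graph_le {f g : ℕ → ℕ} {N M : ℕ} (hf : F.VertexCompatible f)
    (hN : ∀ x < F.n, f x < N) (hg : F.TailCompatible g) (hM : ∀ x < F.n, g x < M) :
    trc F.graph ≤ N + M := by
  have := trc_le F.hasUniquePaths.stronglyConnected (fun i : Fin F.n => f i)
    (fun i : Fin F.n => g i) (Finset.range N) (Finset.range M)
    (fun x => by simpa using hN x x.2) (fun x => by simpa using hM x x.2) hf.injOn hg.injOn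
  simpa using this

theorem length_le_rvc_graph (hu : u < F.n) (hv : v < F.n) : (F.P u v).length ≤ rvc F.graph + 2 := by
  obtain ⟨l, hl⟩ := exists_map_val (n := F.n) fun z => F.mem_lt hu hv (z := z)
  have hp : IsDirPath F.graph ⟨u, hu⟩ ⟨v, hv⟩ l :=
    F.isDirPath_graph.2 (by rw [hl]; exact F.path hu hv)
  have := F.hasUniquePaths.length_le_rvc hp
  rwa [← hl, List.length_map]

theorem le_trc_graph (hn : 0 < F.n) {N : ℕ}
    (h : ∀ k (cV : ℕ → Fin k) (cA : ℕ × ℕ → Fin k),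
      (∀ u < F.n, ∀ v < F.n, IsTotalRainbow cV cA (F.P u v)) → N ≤ k) : N ≤ trc F.graph := by
  have : NeZero F.n := ⟨hn.ne'⟩
  refine le_trc F.hasUniquePaths.stronglyConnected fun k cV cA hk => ?_
  -- Colours are extended from `Fin F.n` to `ℕ` by reduction modulo `F.n`; on labels below `F.n`
  -- nothing changes.
  refine h k (fun z => cV (Fin.ofNat F.n z))
    (fun p => cA (Fin.ofNat F.n p.1, Fin.ofNat F.n p.2)) fun u hu v hv => ?_
  obtain ⟨l, hl⟩ := exists_map_val (n := F.n) fun z => F.mem_lt hu hv (z := z)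
  have hp : IsDirPath F.graph ⟨u, hu⟩ ⟨v, hv⟩ l :=
    F.isDirPath_graph.2 (by rw [hl]; exact F.path hu hv)
  have hr := F.hasUniquePaths.isTotalRainbow hk hp
  unfold IsTotalRainbow at hr ⊢
  rw [← hl, internalVertices_map, pathArcs_map, List.map_map, List.map_map]
  convert hr using 3
  · ext i; simp
  · ext p; simp

end LabelledCactus

end RainbowDigraph

/-! ### Attaching cycles to coloured cacti -/

namespace RainbowDigraph

theorem mem_pathArcs_append_left {V : Type*} {l : List V} {e : V × V} (h : e ∈ pathArcs l)
    (t : List V) : e ∈ pathArcs (l ++ t) := by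
  obtain ⟨x, y⟩ := e
  obtain ⟨p, s, rfl⟩ := mem_pathArcs.1 h
  exact mem_pathArcs.2 ⟨p, s ++ t, by simp⟩

theorem mem_of_mem_pathArcs {V : Type*} {l : List V} {e : V × V} (h : e ∈ pathArcs l) :
    e.1 ∈ l ∧ e.2 ∈ l := by
  obtain ⟨x, y⟩ := e
  obtain ⟨p, s, rfl⟩ := mem_pathArcs.1 h
  simp

section
variable {V α : Type*} {cV : V → α} {cA : V × V → α} {l : List V}

theorem IsTotalRainbow.ne (h : IsTotalRainbow cV cA l) {z : V} {e : V × V}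
    (hz : z ∈ internalVertices l) (he : e ∈ pathArcs l) : cV z ≠ cA e :=
  (List.nodup_append.1 h).2.2 _ (List.mem_map_of_mem hz) _ (List.mem_map_of_mem he)

theorem IsTotalRainbow.arc_ne (h : IsTotalRainbow cV cA l) {e e' : V × V}
    (he : e ∈ pathArcs l) (he' : e' ∈ pathArcs l) (hne : e ≠ e') : cA e ≠ cA e' :=
  fun h' => hne (List.inj_on_of_nodup_map (List.nodup_append.1 h).2.1 he he' h')

end

namespace LabelledCactus

variable {F : LabelledCactus} {w m u v x y z : ℕ} {hw : w < F.n} {hm : 2 ≤ m}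

theorem attach_path (hu : u < F.n) (hv : v < F.n) : (F.attach w m hw hm).P u v = F.P u v := by
  simp [attach, attachPath, hu, hv]

theorem attach_path_new (hu : u < F.n) (hv : F.n ≤ v) :
    (F.attach w m hw hm).P u v = F.P u w ++ List.range' F.n (v + 1 - F.n) := by
  simp [attach, attachPath, hu, Nat.not_lt.2 hv]

theorem attach_path_new_old (hu : F.n ≤ u) (hv : v < F.n) :
    (F.attach w m hw hm).P u v = List.range' u (F.n + m - u) ++ F.P w v := by
  simp [attach, attachPath, hv, Nat.not_lt.2 hu]

/-- Among the old vertices only `w` gains an in-neighbour, so `w` alone has to be excluded. -/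
theorem Source.attach (h : F.Source x y) (hx : x < F.n) (hy : y < F.n) (hxw : x ≠ w) :
    (F.attach w m hw hm).Source x y := by
  intro u hu
  rcases hu with hu | hu | hu | hu
  · rw [attach_path hx hy]; exact h u hu
  all_goals omega

theorem Sink.attach (h : F.Sink x y) (hx : x < F.n) (hy : y < F.n) (hxw : x ≠ w) :
    (F.attach w m hw hm).Sink x y := by
  intro u hu
  rcases hu with hu | hu | hu | hu
  · rw [attach_path hy hx]; exact h u hu
  all_goals omega

theorem source_attach_new (hy : y < F.n) : (F.attach w m hw hm).Source F.n y := by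
  intro u hu
  rcases hu with hu | ⟨rfl, -⟩ | hu | hu
  · have := F.lt hu; omega
  · rw [attach_path_new_old le_rfl hy]
    exact List.mem_append_right _ (F.path hw hy).head_mem
  all_goals omega

theorem sink_attach_new (hy : y < F.n) (hz : F.n ≤ z) (hz' : z + 1 = F.n + m) :
    (F.attach w m hw hm).Sink z y := by
  intro u hu
  rcases hu with hu | hu | hu | ⟨-, -, rfl⟩
  · have := F.lt hu; omega
  · omega
  · omega
  · rw [attach_path_new hy hz]
    exact List.mem_append_left _ (F.path hy hw).last_mem

theorem Source.attach_new (h : F.Source y w) (hy : y < F.n) (hyw : y ≠ w) (hz : F.n ≤ z) :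
    (F.attach w m hw hm).Source y z := by
  intro u hu
  rcases hu with hu | hu | hu | hu
  · rw [attach_path_new hy hz]; exact List.mem_append_left _ (h u hu)
  all_goals omega

theorem Sink.attach_new (h : F.Sink y w) (hy : y < F.n) (hyw : y ≠ w) (hz : F.n ≤ z) :
    (F.attach w m hw hm).Sink y z := by
  intro u hu
  rcases hu with hu | hu | hu | hu
  · rw [attach_path_new_old hz hy]; exact List.mem_append_right _ (h u hu)
  all_goals omega

/-- Sharing between old vertices survives as long as `w`, which gains neighbours, has a colour of
its own. Of the new vertices, the first has `w` as its only in-neighbour and may share with sources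
towards `w`; the last has `w` as its only out-neighbour and may share with sinks. -/
theorem VertexCompatible.attach {f φ : ℕ → ℕ} (hf : F.VertexCompatible f)
    (hfw : ∀ z < F.n, f z = f w → z = w)
    (hφ : ∀ z z', F.n ≤ z → z < F.n + m → F.n ≤ z' → z' < F.n + m → φ z = φ z' → z = z')
    (hfφ : ∀ z, F.n ≤ z → z < F.n + m → ∀ y < F.n, f y = φ z →
      y ≠ w ∧ ((z = F.n ∧ F.Source y w) ∨ (z + 1 = F.n + m ∧ F.Sink y w))) :
    (F.attach w m hw hm).VertexCompatible fun z => if z < F.n then f z else φ z := by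
  have key : ∀ z, F.n ≤ z → z < F.n + m → ∀ y < F.n, f y = φ z →
      ((F.attach w m hw hm).Source y z ∧ (F.attach w m hw hm).Source z y) ∨
      ((F.attach w m hw hm).Sink y z ∧ (F.attach w m hw hm).Sink z y) := by
    intro z hz hz' y hy h
    obtain ⟨hyw, ⟨rfl, hs⟩ | ⟨h1, hs⟩⟩ := hfφ z hz hz' y hy h
    · exact Or.inl ⟨hs.attach_new hy hyw hz, source_attach_new hy⟩
    · exact Or.inr ⟨hs.attach_new hy hyw hz, sink_attach_new hy hz h1⟩
  intro x hx y hy hxy hne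
  change x < F.n + m at hx
  change y < F.n + m at hy
  dsimp only at hxy
  split_ifs at hxy with h1 h2 h2
  · have hxw : x ≠ w := by rintro rfl; exact hne (hfw y h2 hxy.symm).symm
    have hyw : y ≠ w := by rintro rfl; exact hne (hfw x h1 hxy)
    rcases hf x h1 y h2 hxy hne with ⟨a, b⟩ | ⟨a, b⟩
    · exact Or.inl ⟨a.attach h1 h2 hxw, b.attach h2 h1 hyw⟩
    · exact Or.inr ⟨a.attach h1 h2 hxw, b.attach h2 h1 hyw⟩
  · exact key y (by omega) hy x h1 hxy
  · rcases key x (by omega) hx y h2 hxy.symm with ⟨a, b⟩ | ⟨a, b⟩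
    · exact Or.inl ⟨b, a⟩
    · exact Or.inr ⟨b, a⟩
  · exact absurd (hφ x y (by omega) hx (by omega) hy hxy) hne

theorem TailCompatible.attach {g φ : ℕ → ℕ} (hg : F.TailCompatible g)
    (hgw : ∀ z < F.n, g z = g w → z = w)
    (hφ : ∀ z z', F.n ≤ z → z < F.n + m → F.n ≤ z' → z' < F.n + m → φ z = φ z' → z = z')
    (hgφ : ∀ z, F.n ≤ z → z < F.n + m → ∀ y < F.n, g y = φ z →
      y ≠ w ∧ z + 1 = F.n + m ∧ F.Sink y w) :
    (F.attach w m hw hm).TailCompatible fun z => if z < F.n then g z else φ z := by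
  intro x hx y hy hxy hne
  change x < F.n + m at hx
  change y < F.n + m at hy
  dsimp only at hxy
  split_ifs at hxy with h1 h2 h2
  · have hxw : x ≠ w := by rintro rfl; exact hne (hgw y h2 hxy.symm).symm
    have hyw : y ≠ w := by rintro rfl; exact hne (hgw x h1 hxy)
    obtain ⟨a, b⟩ := hg x h1 y h2 hxy hne
    exact ⟨a.attach h1 h2 hxw, b.attach h2 h1 hyw⟩
  · obtain ⟨h3, h4, hs⟩ := hgφ y (by omega) hy x h1 hxy
    exact ⟨hs.attach_new h1 h3 (by omega), sink_attach_new h1 (by omega) h4⟩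
  · obtain ⟨h3, h4, hs⟩ := hgφ x (by omega) hx y h2 hxy.symm
    exact ⟨sink_attach_new h2 (by omega) h4, hs.attach_new h2 h3 (by omega)⟩
  · exact absurd (hφ x y (by omega) hx (by omega) hy hxy) hne

end LabelledCactus

/-- A cactus with a vertex `w` at which further cycles can be attached, a compatible
vertex-colouring `f` with `N` colours and a compatible colouring `g` of the tails of the arcs
with `N + S.length` colours. The colours `x₀`, `x₁` and `y₀` may be used for the first vertex,
the last vertex, and the last tail of a new cycle. The path from `o` to `w` has `N` vertices, and
together with the arcs in `S` it will bound the number of colours from below. -/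
structure Stage where
  F : LabelledCactus
  w : ℕ
  o : ℕ
  N : ℕ
  x₀ : ℕ
  x₁ : ℕ
  y₀ : ℕ
  f : ℕ → ℕ
  g : ℕ → ℕ
  S : List (ℕ × ℕ)
  w_lt : w < F.n
  o_lt : o < F.n
  length_path : (F.P o w).length = N
  f_lt : ∀ z < F.n, f z < N
  x₀_lt : x₀ < N
  x₁_lt : x₁ < N
  x_ne : x₀ ≠ x₁
  g_lt : ∀ z < F.n, g z < N + S.length
  y₀_lt : y₀ < N + S.length
  f_w : ∀ z < F.n, f z = f w → z = w
  f_w_ne₀ : f w ≠ x₀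
  f_w_ne₁ : f w ≠ x₁
  g_w : ∀ z < F.n, g z = g w → z = w
  g_w_ne : g w ≠ y₀
  f_compatible : F.VertexCompatible f
  g_compatible : F.TailCompatible g
  source : ∀ z < F.n, f z = x₀ → F.Source z w
  sink_f : ∀ z < F.n, f z = x₁ → F.Sink z w
  sink_g : ∀ z < F.n, g z = y₀ → F.Sink z w
  extra : ∀ e ∈ S, e.1 < F.n ∧ e.2 ∉ F.P o w ∧ e ∈ pathArcs (F.P e.1 w) ∧
    ∃ z < F.n, ∃ t, F.P o z = F.P o w ++ t ∧ e ∈ pathArcs (F.P o z)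
  extra_pairwise : S.Pairwise fun e e' => e ≠ e' ∧
    ∃ u < F.n, ∃ v < F.n, e ∈ pathArcs (F.P u v) ∧ e' ∈ pathArcs (F.P u v)

/-! ### The extremal cacti and their rainbow numbers -/

namespace Stage

open LabelledCactus

theorem ne_w_of_f₀ (s : Stage) {z : ℕ} (h : s.f z = s.x₀) : z ≠ s.w := by
  rintro rfl; exact s.f_w_ne₀ h

theorem ne_w_of_f₁ (s : Stage) {z : ℕ} (h : s.f z = s.x₁) : z ≠ s.w := by
  rintro rfl; exact s.f_w_ne₁ h

theorem ne_w_of_g (s : Stage) {z : ℕ} (h : s.g z = s.y₀) : z ≠ s.w := by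
  rintro rfl; exact s.g_w_ne h

/-- The single cycle with `t + 3` vertices. -/
theorem exists_cycle (t : ℕ) :
    ∃ s : Stage, s.F.n = t + 3 ∧ s.F.q = 1 ∧ s.S = [] ∧ s.N = t + 3 := by
  have h0 : 0 < point.n := Nat.one_pos
  -- The path `1, …, t + 2, 0` ending at `w = 0` visits the whole cycle. All colours are distinct;
  -- the reusable ones belong to the successor `1` and the predecessor `t + 2` of `w`.
  refine ⟨{ F := point.attach 0 (t + 2) h0 (by omega)
            w := 0, o := 1, N := t + 3, x₀ := 1, x₁ := t + 2, y₀ := t + 2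
            f := id, g := id, S := []
            w_lt := ?_, o_lt := ?_, length_path := ?_, f_lt := ?_, x₀_lt := ?_, x₁_lt := ?_
            x_ne := ?_, g_lt := ?_, y₀_lt := ?_, f_w := ?_, f_w_ne₀ := ?_, f_w_ne₁ := ?_
            g_w := ?_, g_w_ne := ?_, f_compatible := ?_, g_compatible := ?_, source := ?_
            sink_f := ?_, sink_g := ?_, extra := ?_, extra_pairwise := ?_ }, ?_, rfl, rfl, rfl⟩
  · exact Nat.lt_add_right _ h0
  · change 1 < 1 + (t + 2); omega
  · rw [attach_path_new_old (u := 1) (le_refl 1) h0]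
    simp [point]
  · intro z hz; change z < 1 + (t + 2) at hz; simp; omega
  · omega
  · omega
  · omega
  · intro z hz; change z < 1 + (t + 2) at hz; simp; omega
  · simp
  · simp
  · simp
  · simp
  · simp
  · simp
  · intro x _ y _ h h'; exact absurd h h'
  · intro x _ y _ h h'; exact absurd h h'
  · rintro z hz rfl; exact source_attach_new h0
  · rintro z hz rfl
    exact sink_attach_new h0 (by simp [point]) (by simp [point]; omega)
  · rintro z hz rfl
    exact sink_attach_new h0 (by simp [point]) (by simp [point]; omega)
  · simp
  · simp
  · change 1 + (t + 2) = t + 3; omega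

/-- Attaching a triangle whose second new vertex is the new place for attaching cycles. -/
theorem exists_triangle (s : Stage) (hS : s.S = []) :
    ∃ s' : Stage, s'.F.n = s.F.n + 2 ∧ s'.F.q = s.F.q + 1 ∧ s'.S = [] ∧ s'.N = s.N + 2 := by
  have hg : ∀ z < s.F.n, s.g z < s.N := by simpa [hS] using s.g_lt
  have hy : s.y₀ < s.N := by simpa [hS] using s.y₀_lt
  have hx₀ := s.x₀_lt
  have hx₁ := s.x₁_lt
  have hf := s.f_lt
  have hn : ∀ z, z < (s.F.attach s.w 2 s.w_lt le_rfl).n ↔ z < s.F.n + 2 := fun z => Iff.rfl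
  refine ⟨{ F := s.F.attach s.w 2 s.w_lt le_rfl
            w := s.F.n + 1, o := s.o, N := s.N + 2, x₀ := s.x₀, x₁ := s.x₁, y₀ := s.y₀
            f := fun z => if z < s.F.n then s.f z else s.N + (z - s.F.n)
            g := fun z => if z < s.F.n then s.g z else s.N + (z - s.F.n)
            S := []
            w_lt := ?_, o_lt := ?_, length_path := ?_, f_lt := ?_, x₀_lt := ?_, x₁_lt := ?_
            x_ne := ?_, g_lt := ?_, y₀_lt := ?_, f_w := ?_, f_w_ne₀ := ?_, f_w_ne₁ := ?_
            g_w := ?_, g_w_ne := ?_, f_compatible := ?_, g_compatible := ?_, source := ?_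
            sink_f := ?_, sink_g := ?_, extra := ?_, extra_pairwise := ?_ }, rfl, rfl, rfl, rfl⟩
  · rw [hn]; omega
  · rw [hn]; have := s.o_lt; omega
  · rw [attach_path_new s.o_lt (by omega), List.length_append, s.length_path]
    simp; omega
  · intro z hz; rw [hn] at hz; split_ifs with h
    · have := hf z h; omega
    · omega
  · omega
  · omega
  · exact s.x_ne
  · intro z hz; rw [hn] at hz; simp only [List.length_nil]; split_ifs with h
    · have := hg z h; omega
    · omega
  · simp; omega
  · intro z hz h; rw [hn] at hz; split_ifs at h with h1 h2 h2
    · omega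
    · have := hf z h1; omega
    · omega
    · omega
  · rw [if_neg (by omega)]; omega
  · rw [if_neg (by omega)]; omega
  · intro z hz h; rw [hn] at hz; split_ifs at h with h1 h2 h2
    · omega
    · have := hg z h1; omega
    · omega
    · omega
  · rw [if_neg (by omega)]; omega
  · refine s.f_compatible.attach s.f_w ?_ ?_
    · intros; omega
    · intro z _ _ y hy' h; have := hf y hy'; omega
  · refine s.g_compatible.attach s.g_w ?_ ?_
    · intros; omega
    · intro z _ _ y hy' h; have := hg y hy'; omega
  · intro z hz h; split_ifs at h with h1
    · exact (s.source z h1 h).attach_new h1 (s.ne_w_of_f₀ h) (by omega)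
    · omega
  · intro z hz h; split_ifs at h with h1
    · exact (s.sink_f z h1 h).attach_new h1 (s.ne_w_of_f₁ h) (by omega)
    · omega
  · intro z hz h; split_ifs at h with h1
    · exact (s.sink_g z h1 h).attach_new h1 (s.ne_w_of_g h) (by omega)
    · omega
  · simp
  · simp

/-- Attaching a cycle with 4 vertices whose second new vertex is the new place for attaching
cycles. -/
theorem exists_quadrangle (s : Stage) (hS : s.S = []) :
    ∃ s' : Stage, s'.F.n = s.F.n + 3 ∧ s'.F.q = s.F.q + 1 ∧ s'.S = [] ∧ s'.N = s.N + 2 := by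
  have hg : ∀ z < s.F.n, s.g z < s.N := by simpa [hS] using s.g_lt
  have hy : s.y₀ < s.N := by simpa [hS] using s.y₀_lt
  have hx₀ := s.x₀_lt
  have hx₁ := s.x₁_lt
  have hx := s.x_ne
  have hf := s.f_lt
  have h3 : 2 ≤ 3 := by omega
  have hn : ∀ z, z < (s.F.attach s.w 3 s.w_lt h3).n ↔ z < s.F.n + 3 := fun z => Iff.rfl
  -- Three new vertices cost only two colours in either palette. For `f`, the first reuses `x₀`; for
  -- `g`, the last reuses `y₀`. These colours are then given up, since both vertices are adjacent to
  -- the old `w` on the wrong side for the new one. They are replaced by `N + 1`: under `f` it is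
  -- the colour of the successor `n + 2` of the new `w`, under `g` that of its predecessor `n`.
  refine ⟨{ F := s.F.attach s.w 3 s.w_lt h3
            w := s.F.n + 1, o := s.o, N := s.N + 2, x₀ := s.N + 1, x₁ := s.x₁, y₀ := s.N + 1
            f := fun z => if z < s.F.n then s.f z else
              if z = s.F.n then s.x₀ else if z = s.F.n + 1 then s.N else s.N + 1
            g := fun z => if z < s.F.n then s.g z else
              if z = s.F.n then s.N + 1 else if z = s.F.n + 1 then s.N else s.y₀
            S := []
            w_lt := ?_, o_lt := ?_, length_path := ?_, f_lt := ?_, x₀_lt := ?_, x₁_lt := ?_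
            x_ne := ?_, g_lt := ?_, y₀_lt := ?_, f_w := ?_, f_w_ne₀ := ?_, f_w_ne₁ := ?_
            g_w := ?_, g_w_ne := ?_, f_compatible := ?_, g_compatible := ?_, source := ?_
            sink_f := ?_, sink_g := ?_, extra := ?_, extra_pairwise := ?_ }, rfl, rfl, rfl, rfl⟩
  · rw [hn]; omega
  · rw [hn]; have := s.o_lt; omega
  · rw [attach_path_new s.o_lt (by omega), List.length_append, s.length_path]
    simp; omega
  · intro z hz; rw [hn] at hz; split_ifs with h
    · have := hf z h; omega
    all_goals omega
  · omega
  · omega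
  · omega
  · intro z hz; rw [hn] at hz; simp only [List.length_nil]; split_ifs with h
    · have := hg z h; omega
    all_goals omega
  · simp
  · intro z hz h; rw [hn] at hz
    by_cases h1 : z < s.F.n
    · have := hf z h1; simp [h1] at h; omega
    · simp [h1] at h; split_ifs at h <;> omega
  · simp
  · simp; omega
  · intro z hz h; rw [hn] at hz
    by_cases h1 : z < s.F.n
    · have := hg z h1; simp [h1] at h; omega
    · simp [h1] at h; split_ifs at h <;> omega
  · simp
  · refine s.f_compatible.attach s.f_w ?_ ?_
    · intro z z' h1 h2 h3 h4 h; split_ifs at h <;> omega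
    · intro z h1 h2 y hy' h
      have := hf y hy'
      split_ifs at h with h4 h5
      · exact ⟨s.ne_w_of_f₀ h, Or.inl ⟨h4, s.source y hy' h⟩⟩
      all_goals omega
  · refine s.g_compatible.attach s.g_w ?_ ?_
    · intro z z' h1 h2 h3 h4 h; split_ifs at h <;> omega
    · intro z h1 h2 y hy' h
      have := hg y hy'
      split_ifs at h with h4 h5
      · omega
      · omega
      · exact ⟨s.ne_w_of_g h, by omega, s.sink_g y hy' h⟩
  · intro z hz h
    have hz' := hz
    rw [hn] at hz'
    by_cases h1 : z < s.F.n
    · have := hf z h1; simp [h1] at h; omega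
    · have hz2 : z = s.F.n + 2 := by simp [h1] at h; split_ifs at h <;> omega
      intro u hu
      have hu' : u = s.F.n + 1 := by
        have hw := s.w_lt
        rcases hu with hu | hu | hu | hu
        · have := s.F.lt hu; omega
        all_goals omega
      subst hu'
      exact ((s.F.attach s.w 3 s.w_lt h3).path hz (by rw [hn]; omega)).last_mem
  · intro z hz h; rw [hn] at hz
    by_cases h1 : z < s.F.n
    · simp only [h1, if_true] at h
      exact (s.sink_f z h1 h).attach_new h1 (s.ne_w_of_f₁ h) (by omega)
    · simp [h1] at h; split_ifs at h <;> omega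
  · intro z hz h
    have hz' := hz
    rw [hn] at hz'
    by_cases h1 : z < s.F.n
    · have := hg z h1; simp [h1] at h; omega
    · have hz2 : z = s.F.n := by simp [h1] at h; split_ifs at h <;> omega
      intro u hu
      have hu' : u = s.F.n + 1 := by
        have hw := s.w_lt
        rcases hu with hu | hu | hu | hu
        · have := s.F.lt hu; omega
        all_goals omega
      subst hu'
      exact ((s.F.attach s.w 3 s.w_lt h3).path (by rw [hn]; omega) hz).head_mem
  · simp
  · simp

theorem attach_path_last (s : Stage) {u : ℕ} (hu : u < s.F.n) :
    (s.F.attach s.w 2 s.w_lt le_rfl).P u (s.F.n + 1) = s.F.P u s.w ++ [s.F.n] ++ [s.F.n + 1] := by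
  rw [attach_path_new hu (by omega)]
  simp [show s.F.n + 1 + 1 - s.F.n = 2 by omega, List.range'_succ]

/-- Attaching a triangle without changing the place for attaching cycles. -/
theorem exists_leaf (s : Stage) :
    ∃ s' : Stage, s'.F = s.F.attach s.w 2 s.w_lt le_rfl ∧ s'.S.length = s.S.length + 1 ∧
      s'.N = s.N := by
  have hg := s.g_lt
  have hy := s.y₀_lt
  have hx₀ := s.x₀_lt
  have hx₁ := s.x₁_lt
  have hx := s.x_ne
  have hf := s.f_lt
  have hw := s.w_lt
  have hfw := s.f_w
  have hgw := s.g_w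
  have hgw' := hg s.w hw
  have hfw₀ := s.f_w_ne₀
  have hfw₁ := s.f_w_ne₁
  have hgw₀ := s.g_w_ne
  have hn : ∀ z, z < (s.F.attach s.w 2 s.w_lt le_rfl).n ↔ z < s.F.n + 2 := fun z => Iff.rfl
  have hP := fun {u v} => attach_path (F := s.F) (hw := s.w_lt) (hm := le_refl 2) (u := u) (v := v)
  have hlast : (s.F.n, s.F.n + 1) ∈
      pathArcs (s.F.P s.o s.w ++ [s.F.n] ++ [s.F.n + 1]) :=
    mem_pathArcs_concat.2 (Or.inr rfl)
  -- The new vertices reuse `x₀` and `x₁`, and the last tail reuses `y₀`. The one new colour, `N +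
  -- S.length`, goes to the tail of the middle arc, which joins `S` as the witness that it is
  -- needed.
  refine ⟨{ F := s.F.attach s.w 2 s.w_lt le_rfl
            w := s.w, o := s.o, N := s.N, x₀ := s.x₀, x₁ := s.x₁, y₀ := s.y₀
            f := fun z => if z < s.F.n then s.f z else if z = s.F.n then s.x₀ else s.x₁
            g := fun z => if z < s.F.n then s.g z else
              if z = s.F.n then s.N + s.S.length else s.y₀
            S := (s.F.n, s.F.n + 1) :: s.S
            w_lt := ?_, o_lt := ?_, length_path := ?_, f_lt := ?_, x₀_lt := ?_, x₁_lt := ?_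
            x_ne := ?_, g_lt := ?_, y₀_lt := ?_, f_w := ?_, f_w_ne₀ := ?_, f_w_ne₁ := ?_
            g_w := ?_, g_w_ne := ?_, f_compatible := ?_, g_compatible := ?_, source := ?_
            sink_f := ?_, sink_g := ?_, extra := ?_, extra_pairwise := ?_ }, rfl, rfl, rfl⟩
  · rw [hn]; omega
  · rw [hn]; have := s.o_lt; omega
  · rw [hP s.o_lt s.w_lt, s.length_path]
  · intro z hz; split_ifs with h
    · exact hf z h
    all_goals assumption
  · exact hx₀
  · exact hx₁
  · exact hx
  · intro z hz; simp only [List.length_cons]; split_ifs with h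
    · have := hg z h; omega
    all_goals omega
  · simp only [List.length_cons]; omega
  · intro z hz h; simp only [hw, if_true] at h; split_ifs at h with h1 h2
    · exact hfw z h1 h
    · exact absurd h.symm hfw₀
    · exact absurd h.symm hfw₁
  · simpa only [hw, if_true] using hfw₀
  · simpa only [hw, if_true] using hfw₁
  · intro z hz h; simp only [hw, if_true] at h; split_ifs at h with h1 h2
    · exact hgw z h1 h
    · omega
    · exact absurd h.symm hgw₀
  · simpa only [hw, if_true] using hgw₀
  · refine s.f_compatible.attach s.f_w ?_ ?_
    · intro z z' h1 h2 h3 h4 h; split_ifs at h <;> omega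
    · intro z h1 h2 y hy' h
      split_ifs at h with h4
      · exact ⟨s.ne_w_of_f₀ h, Or.inl ⟨h4, s.source y hy' h⟩⟩
      · exact ⟨s.ne_w_of_f₁ h, Or.inr ⟨by omega, s.sink_f y hy' h⟩⟩
  · refine s.g_compatible.attach s.g_w ?_ ?_
    · intro z z' h1 h2 h3 h4 h; split_ifs at h <;> omega
    · intro z h1 h2 y hy' h
      have := hg y hy'
      split_ifs at h with h4
      · omega
      · exact ⟨s.ne_w_of_g h, by omega, s.sink_g y hy' h⟩
  · intro z hz h; split_ifs at h with h1 h2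
    · exact (s.source z h1 h).attach h1 hw (s.ne_w_of_f₀ h)
    · subst h2; exact source_attach_new hw
    · exact absurd h.symm hx
  · intro z hz h; rw [hn] at hz; split_ifs at h with h1 h2
    · exact (s.sink_f z h1 h).attach h1 hw (s.ne_w_of_f₁ h)
    · exact absurd h hx
    · exact sink_attach_new hw (by omega) (by omega)
  · intro z hz h; rw [hn] at hz; split_ifs at h with h1 h2
    · exact (s.sink_g z h1 h).attach h1 hw (s.ne_w_of_g h)
    · omega
    · exact sink_attach_new hw (by omega) (by omega)
  · intro e he
    rw [hn, hP s.o_lt hw]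
    rcases List.mem_cons.1 he with rfl | he
    · refine ⟨by simp, ?_, ?_, s.F.n + 1, by rw [hn]; omega, [s.F.n, s.F.n + 1], ?_, ?_⟩
      · intro h
        have := s.F.mem_lt s.o_lt hw h
        omega
      · rw [attach_path_new_old le_rfl hw, s.F.path_self hw]
        simp [pathArcs, List.range'_succ]
      · rw [s.attach_path_last s.o_lt]; simp
      · rw [s.attach_path_last s.o_lt]; exact hlast
    · obtain ⟨h1, h2, h3, z, hz, t, ht, h4⟩ := s.extra e he
      exact ⟨by omega, h2, by rwa [hP h1 hw], z, by rw [hn]; omega, t, by rwa [hP s.o_lt hz],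
        by rwa [hP s.o_lt hz]⟩
  · refine List.pairwise_cons.2 ⟨fun e he => ?_, s.extra_pairwise.imp ?_⟩
    · obtain ⟨h1, h2, h3, -⟩ := s.extra e he
      refine ⟨?_, e.1, by rw [hn]; omega, s.F.n + 1, by rw [hn]; omega, ?_, ?_⟩
      · rintro rfl; omega
      · rw [s.attach_path_last h1]; exact mem_pathArcs_concat.2 (Or.inr rfl)
      · rw [s.attach_path_last h1, List.append_assoc]
        exact mem_pathArcs_append_left h3 _
    · rintro e e' ⟨hne, u, hu, v, hv, h1, h2⟩
      exact ⟨hne, u, by rw [hn]; omega, v, by rw [hn]; omega, by rwa [hP hu hv], by rwa [hP hu hv]⟩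

/-- Closing with one more triangle costs no vertex colour, while the path from `o` to its last
vertex has `N + 2` vertices, hence `N` internal ones. -/
theorem rvc_attach (s : Stage) : rvc (s.F.attach s.w 2 s.w_lt le_rfl).graph = s.N := by
  apply le_antisymm
  · obtain ⟨s', hF, -, hN⟩ := s.exists_leaf
    rw [← hF, ← hN]
    exact rvc_graph_le s'.f_compatible s'.f_lt
  · have := length_le_rvc_graph (F := s.F.attach s.w 2 s.w_lt le_rfl) (u := s.o) (v := s.F.n + 1)
      (Nat.lt_add_right _ s.o_lt) (by change _ < s.F.n + 2; omega)
    rw [s.attach_path_last s.o_lt] at this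
    simp [s.length_path] at this
    omega

/-- The path from `o` to the last new vertex has `N` internal vertices and `N + 1` arcs. The arcs in
`S` differ in colour from each other and from all of these, because any two of the objects occur on
a common path. -/
theorem trc_attach (s : Stage) :
    trc (s.F.attach s.w 2 s.w_lt le_rfl).graph = 2 * s.N + s.S.length + 1 := by
  apply le_antisymm
  · obtain ⟨s', hF, hS, hN⟩ := s.exists_leaf
    have := trc_graph_le s'.f_compatible s'.f_lt s'.g_compatible s'.g_lt
    rw [hF] at this
    omega
  have hw := s.w_lt
  have ho := s.o_lt
  refine le_trc_graph (Nat.lt_of_le_of_lt (Nat.zero_le _) (Nat.lt_add_right 2 ho))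
    fun k cV cA h => ?_
  have hn : ∀ z, z < (s.F.attach s.w 2 s.w_lt le_rfl).n ↔ z < s.F.n + 2 := fun z => Iff.rfl
  have hold : ∀ u < s.F.n, ∀ v < s.F.n, IsTotalRainbow cV cA (s.F.P u v) := by
    intro u hu v hv
    have := h u (by rw [hn]; omega) v (by rw [hn]; omega)
    rwa [attach_path hu hv] at this
  have hnew : ∀ u < s.F.n, IsTotalRainbow cV cA (s.F.P u s.w ++ [s.F.n] ++ [s.F.n + 1]) := by
    intro u hu
    have := h u (by rw [hn]; omega) (s.F.n + 1) (by rw [hn]; omega)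
    rwa [s.attach_path_last hu] at this
  have hint : ∀ u < s.F.n, internalVertices (s.F.P u s.w ++ [s.F.n] ++ [s.F.n + 1]) =
      (s.F.P u s.w).tail ++ [s.F.n] := by
    intro u hu
    obtain ⟨t, ht⟩ := (s.F.path hu hw).exists_cons
    simp [ht, internalVertices]
  have hlt : ∀ e ∈ s.S, e.2 < s.F.n := fun e he =>
    s.F.mem_lt (s.extra e he).1 hw (mem_of_mem_pathArcs (s.extra e he).2.2.1).2
  have hmain : (((internalVertices (s.F.P s.o s.w ++ [s.F.n] ++ [s.F.n + 1])).map cV ++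
      (pathArcs (s.F.P s.o s.w ++ [s.F.n] ++ [s.F.n + 1])).map cA) ++ s.S.map cA).Nodup := by
    refine List.nodup_append.2 ⟨hnew s.o ho, ?_, ?_⟩
    · rw [List.Nodup, List.pairwise_map]
      refine s.extra_pairwise.imp ?_
      rintro e e' ⟨hne, u, hu, v, hv, h1, h2⟩
      exact (hold u hu v hv).arc_ne h1 h2 hne
    · intro c hc c' hc'
      obtain ⟨e, he, rfl⟩ := List.mem_map.1 hc'
      obtain ⟨he1, he2, he3, z, hz, t, ht, he4⟩ := s.extra e he
      have he5 : e ∉ pathArcs (s.F.P s.o s.w) := fun h => he2 (mem_of_mem_pathArcs h).2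
      have he6 : e ∈ pathArcs (s.F.P e.1 s.w ++ [s.F.n] ++ [s.F.n + 1]) := by
        rw [List.append_assoc]; exact mem_pathArcs_append_left he3 _
      have hne : ∀ x, e ≠ (x, s.F.n) ∧ e ≠ (x, s.F.n + 1) := by
        intro x
        have := hlt e he
        constructor <;> rintro rfl <;> simp at this
      rcases List.mem_append.1 hc with hc | hc
      · obtain ⟨x, hx, rfl⟩ := List.mem_map.1 hc
        rw [hint s.o ho] at hx
        rcases List.mem_append.1 hx with hx | hx
        -- The path from `o` through `w` into the triangle of `e` has `w` as an internal vertex too,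
        -- so it covers all of `P o w` but the end `o`.
        · refine (hold s.o ho z hz).ne ?_ he4
          have htne : t ≠ [] := by
            rintro rfl
            rw [ht, List.append_nil] at he4
            exact he5 he4
          obtain ⟨r, hr⟩ := (s.F.path ho hw).exists_cons
          rw [ht, hr]
          rw [hr] at hx
          simp only [internalVertices, List.cons_append, List.tail_cons] at hx ⊢
          rw [List.dropLast_append_of_ne_nil htne]
          exact List.mem_append_left _ hx
        -- The path from the tail of `e` through `w` into the new triangle contains both `e` and the
        -- internal vertex `s.F.n`.
        · refine (hnew e.1 he1).ne ?_ he6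
          rw [hint e.1 he1]
          exact List.mem_append_right _ hx
      · obtain ⟨e', he', rfl⟩ := List.mem_map.1 hc
        obtain ⟨r, hr⟩ := (s.F.path ho hw).exists_concat
        obtain ⟨r', hr'⟩ := (s.F.path he1 hw).exists_concat
        rw [mem_pathArcs_concat, hr, mem_pathArcs_concat, ← hr] at he'
        rcases he' with (he' | rfl) | rfl
        · refine (hold s.o ho z hz).arc_ne ?_ he4 ?_
          · rw [ht]; exact mem_pathArcs_append_left he' _
          · rintro rfl; exact he5 he'
        · refine (hnew e.1 he1).arc_ne ?_ he6 (hne _).1.symm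
          rw [mem_pathArcs_concat, hr', mem_pathArcs_concat]
          exact Or.inl (Or.inr rfl)
        · exact (hnew e.1 he1).arc_ne (mem_pathArcs_concat.2 (Or.inr rfl)) he6 (hne _).2.symm
  have hcard := hmain.length_le_card
  rw [hint s.o ho] at hcard
  have hpos : 0 < s.N := by
    rw [← s.length_path]; exact List.length_pos_of_ne_nil (s.F.path ho hw).ne_nil
  simp [pathArcs, s.length_path] at hcard
  omega

theorem exists_chain (t a b : ℕ) :
    ∃ s : Stage, s.F.n = t + 3 + 3 * a + 2 * b ∧ s.F.q = 1 + a + b ∧ s.S = [] ∧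
      s.N = t + 3 + 2 * a + 2 * b := by
  induction b with
  | zero =>
    induction a with
    | zero => exact exists_cycle t
    | succ a ih =>
      obtain ⟨s, h1, h2, h3, h4⟩ := ih
      obtain ⟨s', h1', h2', h3', h4'⟩ := s.exists_quadrangle h3
      exact ⟨s', by omega, by omega, h3', by omega⟩
  | succ b ih =>
    obtain ⟨s, h1, h2, h3, h4⟩ := ih
    obtain ⟨s', h1', h2', h3', h4'⟩ := s.exists_triangle h3
    exact ⟨s', by omega, by omega, h3', by omega⟩

theorem exists_leaves (t a b j : ℕ) :
    ∃ s : Stage, s.F.n = t + 3 + 3 * a + 2 * b + 2 * j ∧ s.F.q = 1 + a + b + j ∧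
      s.S.length = j ∧ s.N = t + 3 + 2 * a + 2 * b := by
  induction j with
  | zero =>
    obtain ⟨s, h1, h2, h3, h4⟩ := exists_chain t a b
    exact ⟨s, h1, h2, by rw [h3]; rfl, h4⟩
  | succ j ih =>
    obtain ⟨s, h1, h2, h3, h4⟩ := ih
    obtain ⟨s', hF, h3', h4'⟩ := s.exists_leaf
    have h5 : s'.F.n = s.F.n + 2 := by rw [hF]; rfl
    have h6 : s'.F.q = s.F.q + 1 := by rw [hF]; rfl
    exact ⟨s', by omega, by omega, by omega, by omega⟩

end Stage

/-- For all `t`, `a`, `b`, `j` there is a cactus with `2 + a + b + j` cycles, among them a cycle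
of length `t + 3`, `a` cycles of length 4, and otherwise triangles, with known rainbow connection
numbers. -/
theorem exists_isNQCactus (t a b j : ℕ) :
    ∃ Q : Digraph (Fin (t + 5 + 3 * a + 2 * b + 2 * j)),
      IsNQCactus Q (t + 5 + 3 * a + 2 * b + 2 * j) (2 + a + b + j) ∧
      rvc Q = t + 3 + 2 * a + 2 * b ∧ trc Q = 2 * (t + 3 + 2 * a + 2 * b) + j + 1 := by
  obtain ⟨s, h1, h2, h3, h4⟩ := Stage.exists_leaves t a b j
  have hn : (s.F.attach s.w 2 s.w_lt le_rfl).n = t + 5 + 3 * a + 2 * b + 2 * j := by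
    change s.F.n + 2 = _; omega
  have hq : (s.F.attach s.w 2 s.w_lt le_rfl).q = 2 + a + b + j := by
    change s.F.q + 1 = _; omega
  have hc := (s.F.attach s.w 2 s.w_lt le_rfl).isNQCactus
  have hr := s.rvc_attach
  have ht := s.trc_attach
  rw [hq] at hc
  generalize (s.F.attach s.w 2 s.w_lt le_rfl).graph = Q at hc hr ht
  generalize (s.F.attach s.w 2 s.w_lt le_rfl).n = n at hn Q
  subst hn
  exact ⟨Q, hc, by omega, by omega⟩

end RainbowDigraph

open RainbowDigraph in
theorem theorem5p9 (q : ℕ) (hq : 2 ≤ q) :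
    (∀ k : ℕ, 2 ≤ k → k ≤ 2 * q - 2 →
      ∀ n : ℕ, (Even k → 2 * q + 1 ≤ n) → (Odd k → 2 * q + 2 ≤ n) →
        ∃ Q : Digraph (Fin n), IsNQCactus Q n q ∧ (rvc Q : ℤ) = n - 2 * q + k) ∧
    (∀ k : ℕ, 3 ≤ k → k ≤ 3 * q - 3 → k ≠ 3 * q - 4 →
      ∀ n : ℕ, (k % 3 = 0 → 2 * q + 1 ≤ n) → (k % 3 = 1 → 2 * q + 2 ≤ n) →
        (k % 3 = 2 → 2 * q + 3 ≤ n) →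
        ∃ Q : Digraph (Fin n), IsNQCactus Q n q ∧ (trc Q : ℤ) = 2 * n - 3 * q + k) ∧
    (∀ (n : ℕ) (V : Type*) [Fintype V] (Q : Digraph V),
      IsNQCactus Q n q → (trc Q : ℤ) ≠ 2 * n - 4) := by
  refine ⟨fun k hk hk' n he ho => ?_, fun k hk hk' hk4 n h0 h1 h2 => ?_,
    fun n V _ Q hQ => trc_ne_of_isNQCactus hq hQ⟩
  -- The equations amount to `n = 2q + 1 + t + a` and `k = 2 + a + 2b`; take `a` to be the parity of
  -- `k`.
  · obtain ⟨t, a, b, j, hn, hq', hkk⟩ : ∃ t a b j, n = t + 5 + 3 * a + 2 * b + 2 * j ∧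
        q = 2 + a + b + j ∧ t + 3 + 2 * a + 2 * b + 2 * q = n + k := by
      rcases Nat.even_or_odd k with h | h
      · have := he h
        obtain ⟨r, hr⟩ := h
        exact ⟨n - 2 * q - 1, 0, r - 1, q - r - 1, by omega, by omega, by omega⟩
      · have := ho h
        obtain ⟨r, hr⟩ := h
        exact ⟨n - 2 * q - 2, 1, r - 1, q - r - 2, by omega, by omega, by omega⟩
    subst hn hq'
    obtain ⟨Q, hQ, hr, -⟩ := exists_isNQCactus t a b j
    exact ⟨Q, hQ, by rw [hr]; omega⟩
  -- Now `k = 3 + a + 3b`, so `a` is the residue of `k` modulo 3. For residue 2, `k ≠ 3q - 4` is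
  -- what keeps `j = q - k / 3 - 3` from being negative.
  · obtain ⟨t, a, b, j, hn, hq', hkk⟩ : ∃ t a b j, n = t + 5 + 3 * a + 2 * b + 2 * j ∧
        q = 2 + a + b + j ∧ 2 * (t + 3 + 2 * a + 2 * b) + j + 1 + 3 * q = 2 * n + k := by
      have h3 : k % 3 = 0 ∨ k % 3 = 1 ∨ k % 3 = 2 := by omega
      rcases h3 with h | h | h
      · have := h0 h
        exact ⟨n - 2 * q - 1, 0, k / 3 - 1, q - k / 3 - 1, by omega, by omega, by omega⟩
      · have := h1 h
        exact ⟨n - 2 * q - 2, 1, k / 3 - 1, q - k / 3 - 2, by omega, by omega, by omega⟩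
      · have := h2 h
        exact ⟨n - 2 * q - 3, 2, k / 3 - 1, q - k / 3 - 3, by omega, by omega, by omega⟩
    subst hn hq'
    obtain ⟨Q, hQ, -, ht⟩ := exists_isNQCactus t a b j
    exact ⟨Q, hQ, by rw [ht]; omega⟩
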